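/- **$k$-sparse $\mathcal H_\infty$ synthesis via two SDPs.** All matrices below have entries in $\mathbb F$, where $\mathbb F=\mathbb R$ or $\mathbb F=\mathbb C$, unless said otherwise; $X\succ 0$ means Hermitian positive definite. Consider the plant $$x_{j+1}=Ax_j+B_1w_j+B_2u_j,\quad z_j=C_1x_j+D_{11}w_j+D_{12}u_j,\quad y_j=C_2x_j+D_{21}w_j$$ with $x_j\in\mathbb F^n$, $w_j\in\mathbb F^m$, and controllers $K=(A_K,B_K,C_K,D_K)$ of order $n_K\ge n$, $$\zeta_{j+1}=A_K\zeta_j+B_Ky_j,\qquad u_j=C_K\zeta_j+D_Ky_j .$$ The closed loop $\mathcal M_K$ has the matrices $$A_{cl}=\begin{bmatrix}A+B_2D_KC_2&B_2C_K\\B_KC_2&A_K\end{bmatrix},\ B_{cl}=\begin{bmatrix}B_1+B_2D_KD_{21}\\B_KD_{21}\end{bmatrix},\ C_{cl}=\begin{bmatrix}C_1+D_{12}D_KC_2&D_{12}C_K\end{bmatrix},\ D_{cl}=D_{11}+D_{12}D_KD_{21}.$$ $K$ is stabilizing if $\rho(A_{cl})<1$. Assume that the plant is stabilizable, i.e. some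 controller of some order is stabilizing. For an integer $k\ge0$ and a system $\mathcal M=(A,B,C,D)$ let the relaxed $k$-sparse $\mathcal H_\infty$ norm $\bar\mu^{sdp}_k(\mathcal M)\ge 0$ be given by $$\bar\mu^{sdp}_k(\mathcal M)^2=\sup\operatorname{Tr}\left(\begin{bmatrix}C^*C&C^*D\\D^*C&D^*D\end{bmatrix}V\right)$$ over complex $V=\begin{bmatrix}X&R\\R^*&W\end{bmatrix}\succeq0$ with $X=\begin{bmatrix}A&B\end{bmatrix}V\begin{bmatrix}A^*\\B^*\end{bmatrix}$, $\operatorname{Tr}W\le1$, $\sum_{i,j}|W_{ij}|\le k$. Say that $(Y,\lambda,t)$ is admissible if $Y=Y^*\in\mathbb F^{m\times m}$, $|Y_{ij}|\le t$ for all $i,j$ (that is, $|Y|\le t\mathbf 1\mathbf 1^{\top}$), $t\ge0$, $\lambda\ge0$. *Synthesis problem (S).* Minimize $\lambda+kt$ over $K$, $P_{cl}\succ0$ and admissible $(Y,\lambda,t)$ with $$\begin{bmatrix}A_{cl}^*P_{cl}A_{cl}-P_{cl}&A_{cl}^*P_{cl}B_{cl}\\B_{cl}^*P_{cl}A_{cl}&B_{cl}^*P_{cl}B_{cl}-\lambda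 I-Y\end{bmatrix}+\begin{bmatrix}C_{cl}^*C_{cl}&C_{cl}^*D_{cl}\\D_{cl}^*C_{cl}&D_{cl}^*D_{cl}\end{bmatrix}\prec0.$$ *First SDP (SDP1).* Let $N_c$, $N_o$ be any matrices with orthonormal columns spanning $\ker\begin{bmatrix}B_2^*&D_{12}^*\end{bmatrix}$ and $\ker\begin{bmatrix}C_2&D_{21}\end{bmatrix}$, and let $\Pi_c=\begin{bmatrix}N_c&0\\0&I\end{bmatrix}$, $\Pi_o=\begin{bmatrix}N_o&0\\0&I\end{bmatrix}$. Minimize $\lambda+kt$ over $P,Q$ and admissible $(Y,\lambda,t)$ with $\begin{bmatrix}P&I\\I&Q\end{bmatrix}\succ0$, $$\Pi_c^*\begin{bmatrix}AQA^*-Q&AQC_1^*&B_1\\C_1QA^*&C_1QC_1^*-I&D_{11}\\B_1^*&D_{11}^*&-\lambda I-Y\end{bmatrix}\Pi_c\prec0,\qquad\Pi_o^*\begin{bmatrix}A^*PA-P&A^*PB_1&C_1^*\\B_1^*PA&B_1^*PB_1-\lambda I-Y&D_{11}^*\\C_1&D_{11}&-I\end{bmatrix}\Pi_o\prec0.$$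 *Second SDP (SDP2), for a fixed $P_{cl}$.* Minimize $\lambda+kt$ over $K$ and admissible $(Y,\lambda,t)$ with $$\begin{bmatrix}P_{cl}^{-1}&0&A_{cl}&B_{cl}\\0&I&C_{cl}&D_{cl}\\A_{cl}^*&C_{cl}^*&P_{cl}&0\\B_{cl}^*&D_{cl}^*&0&\lambda I+Y\end{bmatrix}\succ0.$$ Then the following hold. 1. For every stabilizing $K$ of order $n_K$ the supremum defining $\bar\mu^{sdp}_k(\mathcal M_K)^2$ is finite. 2. A triple $(Y,\lambda,t)$ extends to a feasible point of (S) if and only if it extends to a feasible point of (SDP1). 3. There is a real number $\gamma$ such that $\inf\{\bar\mu^{sdp}_k(\mathcal M_K)^2: K\text{ stabilizing of order }n_K\}=\gamma$ and the optimal values (infima) of (S) and of (SDP1) are both $\gamma$; all three problems are feasible. 4. Let $(P,Q,Y,\lambda,t)$ be feasible for (SDP1). There is $P_2\in\mathbb F^{n_K\times n}$ with $P-Q^{-1}=P_2^*P_2$. For every such $P_2$ the matrix $P_{cl}=\begin{bmatrix}P&P_2^*\\P_2&I\end{bmatrix}$ is positive definite, and (SDP2) with this $P_{cl}$ is feasible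 with the same $(Y,\lambda,t)$ and some $K$; its optimal value $\delta$ satisfies $\gamma\le\delta\le\lambda+kt$. For every feasible point $(K,Y',\lambda',t')$ of (SDP2) with this $P_{cl}$, the controller $K$ is stabilizing, $(K,P_{cl},Y',\lambda',t')$ is feasible for (S), and $\bar\mu^{sdp}_k(\mathcal M_K)^2\le\lambda'+kt'$. -/

import Mathlib

open scoped ComplexOrder Matrix

noncomputable section

/-- State-space data of `x⁺ = A x + B w`, `z = C x + D w`. -/
structure StateSpace (𝕜 n m p : Type*) where
  A : Matrix n n 𝕜
  B : Matrix n m 𝕜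
  C : Matrix p n 𝕜
  D : Matrix p m 𝕜

/-- State-space data of the plant `x⁺ = A x + B₁ w + B₂ u`, `z = C₁ x + D₁₁ w + D₁₂ u`,
`y = C₂ x + D₂₁ w`, with state index `n`, disturbance index `m`, control index `r`,
regulated output index `p` and measurement index `q`. -/
structure Plant (𝕜 n m r p q : Type*) where
  A : Matrix n n 𝕜
  B₁ : Matrix n m 𝕜
  B₂ : Matrix n r 𝕜
  C₁ : Matrix p n 𝕜
  D₁₁ : Matrix p m 𝕜
  D₁₂ : Matrix p r 𝕜
  C₂ : Matrix q n 𝕜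
  D₂₁ : Matrix q m 𝕜

/-- Dynamic output-feedback controller `ζ⁺ = A_K ζ + B_K y`, `u = C_K ζ + D_K y` with
controller state index `ν`. -/
structure Controller (𝕜 ν r q : Type*) where
  AK : Matrix ν ν 𝕜
  BK : Matrix ν q 𝕜
  CK : Matrix r ν 𝕜
  DK : Matrix r q 𝕜

variable {𝕜 : Type*} [RCLike 𝕜]
variable {n ν m r p q c : Type*}
variable [Fintype n] [Fintype ν] [Fintype m] [Fintype r] [Fintype p] [Fintype q]
variable [DecidableEq n] [DecidableEq ν] [DecidableEq m] [DecidableEq p]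

/-- A real or complex matrix, seen as a complex matrix. -/
def toComplexMatrix {a b : Type*} (M : Matrix a b 𝕜) : Matrix a b ℂ :=
  M.map (RCLike.map 𝕜 ℂ)

/-- A real or complex system, seen as a complex system. -/
def StateSpace.toComplex (M : StateSpace 𝕜 n m p) : StateSpace ℂ n m p where
  A := toComplexMatrix M.A
  B := toComplexMatrix M.B
  C := toComplexMatrix M.C
  D := toComplexMatrix M.D

/-- Discrete-time stability `ρ(A) < 1`; the spectrum is the complex one also for real `A`. -/
def IsSchurStable (A : Matrix n n 𝕜) : Prop :=
  spectralRadius ℂ (toComplexMatrix A) < 1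

/-! ### The relaxed `k`-sparse norm -/

/-- The constraints of the semidefinite relaxation, on the blocks of `V = [X R; Rᴴ W]`. -/
structure RelaxationFeasible (M : StateSpace ℂ n m p) (k : ℕ)
    (X : Matrix n n ℂ) (R : Matrix n m ℂ) (W : Matrix m m ℂ) : Prop where
  stationary : X = Matrix.fromCols M.A M.B * Matrix.fromBlocks X R Rᴴ W *
    Matrix.fromRows M.Aᴴ M.Bᴴ
  trace_le : W.trace.re ≤ 1
  sum_norm_le : ∑ i, ∑ j, ‖W i j‖ ≤ (k : ℝ)
  posSemidef : (Matrix.fromBlocks X R Rᴴ W).PosSemidef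

/-- The objective `Tr ([CᴴC CᴴD; DᴴC DᴴD] V)` of the semidefinite relaxation. -/
def relaxationObjective (M : StateSpace ℂ n m p)
    (X : Matrix n n ℂ) (R : Matrix n m ℂ) (W : Matrix m m ℂ) : ℝ :=
  (Matrix.fromBlocks (M.Cᴴ * M.C) (M.Cᴴ * M.D) (M.Dᴴ * M.C) (M.Dᴴ * M.D) *
    Matrix.fromBlocks X R Rᴴ W).trace.re

/-- The values of the objective of the semidefinite relaxation at feasible points. -/
def relaxationValues (M : StateSpace 𝕜 n m p) (k : ℕ) : Set ℝ :=
  {v | ∃ X R W, RelaxationFeasible M.toComplex k X R W ∧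
    v = relaxationObjective M.toComplex X R W}

/-- The relaxed `k`-sparse `H∞` norm: its square is the optimal value of the relaxation. -/
def relaxedNorm (M : StateSpace 𝕜 n m p) (k : ℕ) : ℝ :=
  √(sSup (relaxationValues M k))

/-! ### Closed loop -/

/-- The interconnection of plant and controller, with state `(x, ζ)`. -/
def closedLoop (G : Plant 𝕜 n m r p q) (K : Controller 𝕜 ν r q) :
    StateSpace 𝕜 (n ⊕ ν) m p where
  A := Matrix.fromBlocks (G.A + G.B₂ * K.DK * G.C₂) (G.B₂ * K.CK) (K.BK * G.C₂) K.AK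
  B := Matrix.fromRows (G.B₁ + G.B₂ * K.DK * G.D₂₁) (K.BK * G.D₂₁)
  C := Matrix.fromCols (G.C₁ + G.D₁₂ * K.DK * G.C₂) (G.D₁₂ * K.CK)
  D := G.D₁₁ + G.D₁₂ * K.DK * G.D₂₁

/-- The controller makes the closed loop stable. -/
def Stabilizes (G : Plant 𝕜 n m r p q) (K : Controller 𝕜 ν r q) : Prop :=
  IsSchurStable (closedLoop G K).A

/-- Some dynamic output-feedback controller, of some order, stabilizes the plant. -/
def IsStabilizable (G : Plant 𝕜 n m r p q) : Prop :=
  ∃ (d : ℕ) (K : Controller 𝕜 (Fin d) r q), Stabilizes G K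

/-! ### The optimization problems

All of them have the objective `λ + k t`; strict matrix inequalities `M ≺ 0` are written
`(-M).PosDef`. -/

/-- The constraints shared by all problems: `|Y| ≤ t 11ᵀ`, `Y = Yᴴ`, `t ≥ 0`, `λ ≥ 0`. -/
structure SparsityConstraints (Y : Matrix m m 𝕜) (lam t : ℝ) : Prop where
  abs_le : ∀ i j, ‖Y i j‖ ≤ t
  isHermitian : Y.IsHermitian
  t_nonneg : 0 ≤ t
  lam_nonneg : 0 ≤ lam

/-- The synthesis problem (a bilinear matrix inequality). -/
structure SynthesisFeasible (G : Plant 𝕜 n m r p q) (K : Controller 𝕜 ν r q)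
    (Pcl : Matrix (n ⊕ ν) (n ⊕ ν) 𝕜) (Y : Matrix m m 𝕜) (lam t : ℝ) : Prop where
  sparsity : SparsityConstraints Y lam t
  Pcl_posDef : Pcl.PosDef
  lmi : let S := closedLoop G K
    (-(Matrix.fromBlocks
        (S.Aᴴ * Pcl * S.A - Pcl) (S.Aᴴ * Pcl * S.B)
        (S.Bᴴ * Pcl * S.A) (S.Bᴴ * Pcl * S.B - lam • (1 : Matrix m m 𝕜) - Y) +
      Matrix.fromBlocks
        (S.Cᴴ * S.C) (S.Cᴴ * S.D)
        (S.Dᴴ * S.C) (S.Dᴴ * S.D))).PosDef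

/-- `N` has orthonormal columns that span the kernel of `M`. -/
structure IsOrthonormalKernelBasis {a b : Type*} [Fintype a] [DecidableEq c] [Fintype c]
    (M : Matrix b a 𝕜) (N : Matrix a c 𝕜) : Prop where
  range_eq_ker : LinearMap.range N.mulVecLin = LinearMap.ker M.mulVecLin
  orthonormal : Nᴴ * N = 1

/-- The first semidefinite program, in the variables `P, Q, Y, λ, t`. The columns of `Nc` span
the kernel of `[B₂ᴴ D₁₂ᴴ]` and those of `No` the kernel of `[C₂ D₂₁]`. -/
structure PQFeasible {cc co : Type*} [Fintype cc] [Fintype co]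
    (G : Plant 𝕜 n m r p q) (Nc : Matrix (n ⊕ p) cc 𝕜) (No : Matrix (n ⊕ m) co 𝕜)
    (P Q : Matrix n n 𝕜) (Y : Matrix m m 𝕜) (lam t : ℝ) : Prop where
  sparsity : SparsityConstraints Y lam t
  coupling : (Matrix.fromBlocks P 1 1 Q).PosDef
  control_lmi :
    let Pic : Matrix ((n ⊕ p) ⊕ m) (cc ⊕ m) 𝕜 := Matrix.fromBlocks Nc 0 0 1
    (-(Picᴴ * Matrix.fromBlocks
      (Matrix.fromBlocks
        (G.A * Q * G.Aᴴ - Q) (G.A * Q * G.C₁ᴴ)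
        (G.C₁ * Q * G.Aᴴ) (G.C₁ * Q * G.C₁ᴴ - 1))
      (Matrix.fromRows G.B₁ G.D₁₁)
      (Matrix.fromCols G.B₁ᴴ G.D₁₁ᴴ)
      (-(lam • (1 : Matrix m m 𝕜)) - Y) * Pic)).PosDef
  observe_lmi :
    let Pio : Matrix ((n ⊕ m) ⊕ p) (co ⊕ p) 𝕜 := Matrix.fromBlocks No 0 0 1
    (-(Pioᴴ * Matrix.fromBlocks
      (Matrix.fromBlocks
        (G.Aᴴ * P * G.A - P) (G.Aᴴ * P * G.B₁)
        (G.B₁ᴴ * P * G.A) (G.B₁ᴴ * P * G.B₁ - lam • (1 : Matrix m m 𝕜) - Y))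
      (Matrix.fromRows G.C₁ᴴ G.D₁₁ᴴ)
      (Matrix.fromCols G.C₁ G.D₁₁)
      (-1) * Pio)).PosDef

/-- The matrix `P_cl = [P P₂ᴴ; P₂ I]`. -/
def reconstructedPcl (P : Matrix n n 𝕜) (P₂ : Matrix ν n 𝕜) :
    Matrix (n ⊕ ν) (n ⊕ ν) 𝕜 :=
  Matrix.fromBlocks P P₂ᴴ P₂ 1

/-- The second semidefinite program, in the variables `A_K, B_K, C_K, D_K, Y, λ, t`, for a
fixed matrix `P_cl`. -/
structure ConstructionFeasible (G : Plant 𝕜 n m r p q) (Pcl : Matrix (n ⊕ ν) (n ⊕ ν) 𝕜)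
    (K : Controller 𝕜 ν r q) (Y : Matrix m m 𝕜) (lam t : ℝ) : Prop where
  sparsity : SparsityConstraints Y lam t
  lmi : let S := closedLoop G K
    (Matrix.fromBlocks
      (Matrix.fromBlocks Pcl⁻¹ 0 0 (1 : Matrix p p 𝕜))
      (Matrix.fromBlocks S.A S.B S.C S.D)
      (Matrix.fromBlocks S.Aᴴ S.Cᴴ S.Bᴴ S.Dᴴ)
      (Matrix.fromBlocks Pcl 0 0 (lam • (1 : Matrix m m 𝕜) + Y))).PosDef

end

/-!
The relaxed norm is the value of a semidefinite program whose Lagrangian dual is the strict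
dissipation inequality: a separating hyperplane provides the multipliers, Schur stability of the
closed loop excludes recession directions and hence gives the Slater condition, and the `ℓ¹` bound
on `W` dualizes to the entrywise bound on `Y`.

A Schur complement makes the dissipation inequality affine in the controller parameters, so the
projection lemma eliminates them. The two remaining inequalities, compressed to the kernels, involve
only the top-left block `P` of `P_cl` and the top-left block `Q` of `P_cl⁻¹`. These satisfy
`P ≥ Q⁻¹`, and a small perturbation of `P` makes this strict. Conversely, when `P - Q⁻¹ = P₂ᴴ P₂`,
the matrix with blocks `P`, `P₂ᴴ`, `P₂`, `1` is a storage matrix having the prescribed `P` and `Q`.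
-/

noncomputable section

section Quadratic

open Matrix

variable {𝕜 : Type*} [RCLike 𝕜] {ι κ : Type*} [Fintype ι] [Fintype κ]

/-- The real inner product `Re (xᴴ y)` of vectors over `𝕜`, as a real bilinear map, so that strict
matrix inequalities become inequalities between real quadratic forms. -/
def reInner : (ι → 𝕜) →ₗ[ℝ] (ι → 𝕜) →ₗ[ℝ] ℝ :=
  LinearMap.mk₂ ℝ (fun x y => RCLike.re (star x ⬝ᵥ y))
    (fun x y z => by simp [add_dotProduct]) (fun a x y => by simp [RCLike.smul_re])
    (fun x y z => by simp [dotProduct_add]) (fun a x y => by simp [RCLike.smul_re])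

theorem reInner_apply (x y : ι → 𝕜) : reInner x y = RCLike.re (star x ⬝ᵥ y) := rfl

theorem reInner_comm (x y : ι → 𝕜) : reInner x y = reInner y x := by
  rw [reInner_apply, ← RCLike.conj_re, starRingEnd_apply, ← star_dotProduct_star, star_star,
    dotProduct_comm, dotProduct_comm, reInner_apply]

theorem reInner_mulVec (x : ι → 𝕜) (M : Matrix ι κ 𝕜) (y : κ → 𝕜) :
    reInner x (M *ᵥ y) = reInner (Mᴴ *ᵥ x) y := by
  rw [reInner_apply, dotProduct_mulVec, reInner_apply, star_mulVec, conjTranspose_conjTranspose]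

theorem reInner_conj_mulVec (F : Matrix ι κ 𝕜) (M : Matrix ι ι 𝕜) (x : κ → 𝕜) :
    reInner x ((Fᴴ * M * F) *ᵥ x) = reInner (F *ᵥ x) (M *ᵥ (F *ᵥ x)) := by
  rw [← mulVec_mulVec, ← mulVec_mulVec, reInner_mulVec, conjTranspose_conjTranspose]

theorem reInner_sumElim (x₁ y₁ : ι → 𝕜) (x₂ y₂ : κ → 𝕜) :
    reInner (Sum.elim x₁ x₂) (Sum.elim y₁ y₂) = reInner x₁ y₁ + reInner x₂ y₂ := by
  simp [reInner_apply, dotProduct]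

theorem posDef_iff_reInner_pos {M : Matrix ι ι 𝕜} :
    M.PosDef ↔ M.IsHermitian ∧ ∀ x, x ≠ 0 → 0 < reInner x (M *ᵥ x) := by
  rw [posDef_iff_dotProduct_mulVec]
  refine and_congr_right fun hM => forall₂_congr fun x _ => ?_
  rw [RCLike.pos_iff, hM.im_star_dotProduct_mulVec_self x, reInner_apply, and_iff_left rfl]

theorem posSemidef_iff_reInner_nonneg {M : Matrix ι ι 𝕜} :
    M.PosSemidef ↔ M.IsHermitian ∧ ∀ x, 0 ≤ reInner x (M *ᵥ x) := by
  rw [posSemidef_iff_dotProduct_mulVec]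
  refine and_congr_right fun hM => forall_congr' fun x => ?_
  rw [RCLike.nonneg_iff, hM.im_star_dotProduct_mulVec_self x, reInner_apply, and_iff_left rfl]

theorem nonsing_inv_inv_of_posDef [DecidableEq ι] {M : Matrix ι ι 𝕜} (hM : M.PosDef) :
    M⁻¹⁻¹ = M :=
  nonsing_inv_nonsing_inv _ ((isUnit_iff_isUnit_det _).1 hM.isUnit)

theorem mulVec_inv_mulVec_of_posDef [DecidableEq ι] {M : Matrix ι ι 𝕜} (hM : M.PosDef)
    (x : ι → 𝕜) : M *ᵥ (M⁻¹ *ᵥ x) = x := by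
  rw [mulVec_mulVec, mul_nonsing_inv _ ((isUnit_iff_isUnit_det _).1 hM.isUnit), one_mulVec]

theorem reInner_complete_square [DecidableEq ι] {M : Matrix ι ι 𝕜} (hM : M.PosDef)
    (x y : ι → 𝕜) :
    reInner x (M *ᵥ x) + 2 * reInner y x =
      reInner (x + M⁻¹ *ᵥ y) (M *ᵥ (x + M⁻¹ *ᵥ y)) - reInner y (M⁻¹ *ᵥ y) := by
  have hcross : reInner (M⁻¹ *ᵥ y) (M *ᵥ x) = reInner y x := by
    rw [reInner_mulVec, hM.isHermitian.eq, mulVec_inv_mulVec_of_posDef hM]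
  simp only [mulVec_add, mulVec_inv_mulVec_of_posDef hM, map_add, LinearMap.add_apply, hcross,
    reInner_comm x y, reInner_comm (M⁻¹ *ᵥ y) y]
  ring

theorem forall_reInner_mulVec_add_pos_iff [DecidableEq ι] {M : Matrix ι ι 𝕜} (hM : M.PosDef)
    (y : ι → 𝕜) (c : ℝ) :
    (∀ x, 0 < reInner x (M *ᵥ x) + 2 * reInner y x + c) ↔ reInner y (M⁻¹ *ᵥ y) < c := by
  simp only [reInner_complete_square hM]
  refine ⟨fun h => ?_, fun h x => ?_⟩
  · simpa using h (-(M⁻¹ *ᵥ y))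
  · linarith [(posSemidef_iff_reInner_nonneg.1 hM.posSemidef).2 (x + M⁻¹ *ᵥ y)]

theorem posDef_fromBlocks_iff₁₁ {κ : Type*} [Finite κ] [DecidableEq ι] {A : Matrix ι ι 𝕜}
    (hA : A.PosDef) (B : Matrix ι κ 𝕜) (D : Matrix κ κ 𝕜) :
    (fromBlocks A B Bᴴ D).PosDef ↔ (D - Bᴴ * A⁻¹ * B).PosDef := by
  classical
  have := Fintype.ofFinite κ
  let := hA.isUnit.invertible
  have hpsd := hA.fromBlocks₁₁ B D
  have hunit := isUnit_fromBlocks_iff_of_invertible₁₁ (A := A) (B := B) (C := Bᴴ) (D := D)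
  rw [invOf_eq_nonsing_inv] at hunit
  exact ⟨fun h => (hpsd.1 h.posSemidef).posDef_iff_isUnit.2 (hunit.1 h.isUnit),
    fun h => (hpsd.2 h.posSemidef).posDef_iff_isUnit.2 (hunit.2 h.isUnit)⟩

theorem posDef_fromBlocks_iff₂₂ {ι : Type*} [Finite ι] [DecidableEq κ] (A : Matrix ι ι 𝕜)
    (B : Matrix ι κ 𝕜) {D : Matrix κ κ 𝕜} (hD : D.PosDef) :
    (fromBlocks A B Bᴴ D).PosDef ↔ (A - B * D⁻¹ * Bᴴ).PosDef := by
  classical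
  have := Fintype.ofFinite ι
  let := hD.isUnit.invertible
  have hpsd := hD.fromBlocks₂₂ A B
  have hunit := isUnit_fromBlocks_iff_of_invertible₂₂ (A := A) (B := B) (C := Bᴴ) (D := D)
  rw [invOf_eq_nonsing_inv] at hunit
  exact ⟨fun h => (hpsd.1 h.posSemidef).posDef_iff_isUnit.2 (hunit.1 h.isUnit),
    fun h => (hpsd.2 h.posSemidef).posDef_iff_isUnit.2 (hunit.2 h.isUnit)⟩

end Quadratic

section Alternatives

open Matrix

variable {𝕜 : Type*} [RCLike 𝕜] {ι κ μ ρ : Type*} [Fintype ι] [Fintype κ] [Fintype μ]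

theorem re_trace_conjTranspose_mul_mul (F : Matrix ι κ 𝕜) (M : Matrix ι ι 𝕜) :
    RCLike.re (Fᴴ * M * F).trace = ∑ j, reInner (F.col j) (M *ᵥ F.col j) := by
  rw [trace, map_sum]
  refine Finset.sum_congr rfl fun j _ => ?_
  rw [diag_apply, Matrix.mul_assoc]
  rfl

theorem re_trace_mul_conjTranspose_of_isHermitian {Z : Matrix ι ι 𝕜} (hZ : Z.IsHermitian)
    (M : Matrix ι ι 𝕜) : RCLike.re (Z * Mᴴ).trace = RCLike.re (Z * M).trace := by
  rw [← RCLike.conj_re (Z * M).trace, starRingEnd_apply, ← trace_conjTranspose,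
    conjTranspose_mul, hZ.eq, trace_mul_comm]

open scoped MatrixOrder in
theorem exists_eq_conjTranspose_mul_self_of_posSemidef {M : Matrix ι ι 𝕜} (hM : M.PosSemidef)
    (hcard : Fintype.card ι ≤ Fintype.card κ) : ∃ L : Matrix κ ι 𝕜, M = Lᴴ * L := by
  classical
  obtain ⟨B, rfl⟩ := CStarAlgebra.nonneg_iff_eq_star_mul_self.mp hM.nonneg
  obtain ⟨e⟩ := Function.Embedding.nonempty_of_card_le hcard
  let J : Matrix κ ι 𝕜 := (1 : Matrix κ κ 𝕜).submatrix id e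
  have hJ : Jᴴ * J = 1 := by
    rw [conjTranspose_submatrix, conjTranspose_one, ← submatrix_mul _ _ _ _ _ Function.bijective_id,
      Matrix.one_mul, submatrix_one_embedding]
  refine ⟨J * B, ?_⟩
  rw [conjTranspose_mul, Matrix.mul_assoc, ← Matrix.mul_assoc Jᴴ, hJ, Matrix.one_mul,
    star_eq_conjTranspose]

/-- Positive definiteness of a quadratic form on a kernel: `H` is positive on the nonzero vectors
annihilated by `L`. Projected matrix inequalities `Nᴴ H N ≻ 0`, with the columns of `N` spanning
`ker L`, are of this form. -/
def PosDefOnKer (H : Matrix ι ι 𝕜) (L : Matrix ρ ι 𝕜) : Prop :=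
  ∀ x, x ≠ 0 → L *ᵥ x = 0 → 0 < reInner x (H *ᵥ x)

theorem PosDefOnKer.reInner_nonneg {H : Matrix ι ι 𝕜} {L : Matrix ρ ι 𝕜} (hH : PosDefOnKer H L)
    {x : ι → 𝕜} (hx : L *ᵥ x = 0) : 0 ≤ reInner x (H *ᵥ x) := by
  rcases eq_or_ne x 0 with rfl | hne
  · simp
  · exact (hH x hne hx).le

omit [Fintype μ] in
theorem mulVec_col_eq_zero {L : Matrix ρ ι 𝕜} {F : Matrix ι μ 𝕜} (hF : L * F = 0) (j : μ) :
    L *ᵥ F.col j = 0 :=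
  funext fun i => congrFun (congrFun hF i) j

theorem re_trace_mul_nonneg {Z M : Matrix ι ι 𝕜} (hZ : Z.PosSemidef) (hM : M.PosSemidef) :
    0 ≤ RCLike.re (Z * M).trace := by
  obtain ⟨B, rfl⟩ := exists_eq_conjTranspose_mul_self_of_posSemidef hZ le_rfl
  rw [Matrix.mul_assoc, trace_mul_comm]
  exact (RCLike.nonneg_iff.1 (hM.mul_mul_conjTranspose_same B).trace_nonneg).1

theorem PosDefOnKer.of_posDef {M : Matrix ι ι 𝕜} (hM : M.PosDef) (L : Matrix ρ ι 𝕜) :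
    PosDefOnKer M L :=
  fun x hx _ => (posDef_iff_reInner_pos.1 hM).2 x hx

theorem PosDefOnKer.re_trace_nonneg {H : Matrix ι ι 𝕜} {L : Matrix ρ ι 𝕜} (hH : PosDefOnKer H L)
    {F : Matrix ι μ 𝕜} (hF : L * F = 0) : 0 ≤ RCLike.re (Fᴴ * H * F).trace := by
  rw [re_trace_conjTranspose_mul_mul]
  exact Finset.sum_nonneg fun j _ => hH.reInner_nonneg (mulVec_col_eq_zero hF j)

theorem PosDefOnKer.eq_zero_of_re_trace_nonpos {H : Matrix ι ι 𝕜} {L : Matrix ρ ι 𝕜}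
    (hH : PosDefOnKer H L) {F : Matrix ι μ 𝕜} (hF : L * F = 0)
    (htrace : RCLike.re (Fᴴ * H * F).trace ≤ 0) : F = 0 := by
  have hnonneg (j) : 0 ≤ reInner (F.col j) (H *ᵥ F.col j) :=
    hH.reInner_nonneg (mulVec_col_eq_zero hF j)
  rw [re_trace_conjTranspose_mul_mul] at htrace
  have hzero := (Finset.sum_eq_zero_iff_of_nonneg fun j _ => hnonneg j).1
    (htrace.antisymm (Finset.sum_nonneg fun j _ => hnonneg j))
  have hcol (j) : F.col j = 0 := by
    by_contra hne
    exact (hH _ hne (mulVec_col_eq_zero hF j)).ne' (hzero j (Finset.mem_univ j))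
  exact Matrix.ext fun i j => congrFun (hcol j) i

theorem eq_zero_of_re_trace_mul_nonpos {Z M : Matrix ι ι 𝕜} (hZ : Z.PosSemidef) (hM : M.PosDef)
    (h : RCLike.re (Z * M).trace ≤ 0) : Z = 0 := by
  obtain ⟨B, rfl⟩ := exists_eq_conjTranspose_mul_self_of_posSemidef hZ le_rfl
  have hB : Bᴴ = 0 := (PosDefOnKer.of_posDef hM (0 : Matrix ι ι 𝕜)).eq_zero_of_re_trace_nonpos
    (Matrix.zero_mul _) <| by
      rwa [conjTranspose_conjTranspose, Matrix.mul_assoc, trace_mul_comm, Matrix.mul_assoc,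
        trace_mul_comm]
  rw [hB, Matrix.zero_mul]

theorem nonneg_of_forall_pos_add_mul_nonneg {a b : ℝ} (h : ∀ ε > 0, 0 ≤ a + ε * b) : 0 ≤ a := by
  have hlim : Filter.Tendsto (fun ε : ℝ => a + ε * b) (nhdsWithin 0 (Set.Ioi 0)) (nhds a) := by
    have hcont : Continuous fun ε : ℝ => a + ε * b := by fun_prop
    simpa using (hcont.tendsto 0).mono_left nhdsWithin_le_nhds
  exact ge_of_tendsto hlim (eventually_mem_nhdsWithin.mono h)

theorem nonpos_and_nonneg_of_forall_pos_mul_lt {a u : ℝ} (h : ∀ s > 0, s * a < u) :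
    a ≤ 0 ∧ 0 ≤ u := by
  constructor
  · by_contra! ha
    have := h ((|u| + 1) / a) (by positivity)
    rw [div_mul_cancel₀ _ ha.ne'] at this
    linarith [le_abs_self u]
  · refine nonneg_of_forall_pos_add_mul_nonneg (b := -a) fun s hs => ?_
    linarith [h s hs]

theorem posSemidef_of_forall_posDef_re_trace_nonneg {Z : Matrix ι ι 𝕜} (hZ : Z.IsHermitian)
    (h : ∀ M : Matrix ι ι 𝕜, M.PosDef → 0 ≤ RCLike.re (Z * M).trace) : Z.PosSemidef := by
  classical
  refine posSemidef_iff_reInner_nonneg.2 ⟨hZ, fun x => ?_⟩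
  refine nonneg_of_forall_pos_add_mul_nonneg (b := RCLike.re Z.trace) fun ε hε => ?_
  have hε' : (ε • (1 : Matrix ι ι 𝕜)).PosDef := PosDef.one.smul hε
  have hx := h _ (PosDef.posSemidef_add (posSemidef_vecMulVec_self_star x) hε')
  simpa [Matrix.mul_add, mul_vecMulVec, trace_vecMulVec, dotProduct_comm, RCLike.smul_re,
    reInner_apply] using hx

theorem exists_isHermitian_re_trace_mul_eq (f : Matrix ι ι 𝕜 →ₗ[𝕜] 𝕜) :
    ∃ Z : Matrix ι ι 𝕜, Z.IsHermitian ∧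
      ∀ M : Matrix ι ι 𝕜, M.IsHermitian → RCLike.re (Z * M).trace = RCLike.re (f M) := by
  classical
  let Z₀ : Matrix ι ι 𝕜 := of fun j i => f (single i j 1)
  have htrace (M : Matrix ι ι 𝕜) : (Z₀ * M).trace = f M := by
    conv_rhs => rw [matrix_eq_sum_single M]
    simp only [trace, diag_apply, mul_apply, map_sum, Z₀, of_apply]
    rw [Finset.sum_comm]
    refine Finset.sum_congr rfl fun i _ => Finset.sum_congr rfl fun j _ => ?_
    rw [← mul_one (M i j), ← smul_eq_mul (M i j) 1, ← smul_single, map_smul, smul_eq_mul,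
      mul_comm, smul_eq_mul, mul_one]
  have hherm : ((2⁻¹ : ℝ) • (Z₀ + Z₀ᴴ)).IsHermitian :=
    (isHermitian_add_transpose_self Z₀).smul (IsSelfAdjoint.all _)
  refine ⟨_, hherm, fun M hM => ?_⟩
  have hadj : RCLike.re (Z₀ᴴ * M).trace = RCLike.re (f M) := by
    rw [trace_mul_comm, re_trace_mul_conjTranspose_of_isHermitian hM, trace_mul_comm, htrace]
  rw [smul_mul_assoc, trace_smul, RCLike.smul_re, add_mul, trace_add, map_add, hadj, htrace]
  ring

theorem isOpen_setOf_posDefOnKer (L : Matrix ρ ι 𝕜) :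
    IsOpen {H : Matrix ι ι 𝕜 | PosDefOnKer H L} := by
  have hcont : Continuous fun p : Matrix ι ι 𝕜 × (ι → 𝕜) => reInner p.2 (p.1 *ᵥ p.2) :=
    RCLike.continuous_re.comp
      (continuous_snd.star.dotProduct (continuous_fst.matrix_mulVec continuous_snd))
  set K : Set (ι → 𝕜) := Metric.sphere 0 1 ∩ {x | L *ᵥ x = 0}
  have hcompact : IsCompact K := (isCompact_sphere _ _).inter_right
    (isClosed_eq (continuous_const.matrix_mulVec continuous_id) continuous_const)
  have hsphere : {H : Matrix ι ι 𝕜 | PosDefOnKer H L} =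
      {H | ∀ x ∈ K, 0 < reInner x (H *ᵥ x)} := by
    ext H
    refine ⟨fun h x hx => h x (Metric.ne_of_mem_sphere hx.1 one_ne_zero) hx.2,
      fun h x hx hLx => ?_⟩
    have hnorm := h (‖x‖⁻¹ • x) ⟨by simp [norm_smul, hx], by simp [mulVec_smul, hLx]⟩
    rw [mulVec_smul, map_smul, map_smul, LinearMap.smul_apply, smul_smul, smul_eq_mul] at hnorm
    exact pos_of_mul_pos_right hnorm (mul_self_nonneg _)
  rw [hsphere, isOpen_iff_eventually]
  exact fun M hM => hcompact.eventually_forall_of_forall_eventually fun x hx =>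
    hcont.continuousAt.eventually (lt_mem_nhds (hM x hx))

theorem exists_posSemidef_of_forall_not_posDef {S : Set (Matrix ι ι 𝕜)} (hne : S.Nonempty)
    (hconv : Convex ℝ S) (hherm : ∀ M ∈ S, M.IsHermitian) (hS : ∀ M ∈ S, ¬ M.PosDef) :
    ∃ Z : Matrix ι ι 𝕜, Z.PosSemidef ∧ Z ≠ 0 ∧ ∀ M ∈ S, RCLike.re (Z * M).trace ≤ 0 := by
  classical
  set Ω : Set (Matrix ι ι 𝕜) := {M | PosDefOnKer M (0 : Matrix ι ι 𝕜)} with hΩ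
  have hΩconv : Convex ℝ Ω := by
    have hhalf (x : ι → 𝕜) : Convex ℝ {M : Matrix ι ι 𝕜 | 0 < reInner x (M *ᵥ x)} :=
      convex_halfSpace_gt ⟨fun M N => by simp [add_mulVec], fun c M => by simp [smul_mulVec]⟩ 0
    simpa only [hΩ, PosDefOnKer, zero_mulVec, forall_const, Set.ofPred_forall] using
      convex_iInter₂ fun x _ => hhalf x
  have hdisj : Disjoint Ω S := Set.disjoint_left.2 fun M hM hMS =>
    hS M hMS (posDef_iff_reInner_pos.2
      ⟨hherm M hMS, fun x hx => hM x hx (zero_mulVec x)⟩)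
  obtain ⟨f, u, hfΩ, hfS⟩ := RCLike.geometric_hahn_banach_open (𝕜 := 𝕜) hΩconv
    (isOpen_setOf_posDefOnKer 0) hconv hdisj
  obtain ⟨Z, hZ, hZf⟩ := exists_isHermitian_re_trace_mul_eq (-f.toLinearMap)
  have hZf' (M : Matrix ι ι 𝕜) (hM : M.IsHermitian) :
      RCLike.re (Z * M).trace = -RCLike.re (f M) := by simpa using hZf M hM
  have hcone (M : Matrix ι ι 𝕜) (hM : M.PosDef) : RCLike.re (f M) ≤ 0 ∧ 0 ≤ u := by
    refine nonpos_and_nonneg_of_forall_pos_mul_lt fun s hs => ?_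
    have := hfΩ _ (PosDefOnKer.of_posDef (hM.smul hs) 0)
    rwa [RCLike.real_smul_eq_coe_smul (K := 𝕜), map_smul, smul_eq_mul, RCLike.re_ofReal_mul] at this
  have hu : 0 ≤ u := (hcone 1 .one).2
  refine ⟨Z, posSemidef_of_forall_posDef_re_trace_nonneg hZ fun M hM => ?_, ?_, fun M hM => ?_⟩
  · rw [hZf' M hM.isHermitian]
    linarith [(hcone M hM).1]
  · rintro rfl
    obtain ⟨M, hM⟩ := hne
    have hone : RCLike.re (f 1) = 0 := by simpa using hZf' 1 isHermitian_one
    have hM0 : RCLike.re (f M) = 0 := by simpa using hZf' M (hherm M hM)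
    linarith [hfΩ 1 (PosDefOnKer.of_posDef .one 0), hfS M hM]
  · rw [hZf' M (hherm M hM)]
    linarith [hfS M hM]

theorem trace_fromBlocks {R : Type*} [AddCommMonoid R] (A : Matrix ι ι R) (B : Matrix ι κ R)
    (C : Matrix κ ι R) (D : Matrix κ κ R) : (fromBlocks A B C D).trace = A.trace + D.trace := by
  simp [trace]

theorem trace_mul_fromBlocks_zero_zero {R : Type*} [NonUnitalNonAssocSemiring R]
    (Z : Matrix (ι ⊕ κ) (ι ⊕ κ) R) (A : Matrix ι ι R) (D : Matrix κ κ R) :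
    (Z * fromBlocks A 0 0 D).trace = (Z.toBlocks₁₁ * A).trace + (Z.toBlocks₂₂ * D).trace := by
  rw [← fromBlocks_toBlocks Z, fromBlocks_multiply, trace_fromBlocks]
  simp

/-- Lagrange multipliers under Slater's condition, for the problem of maximizing `p.2` over the
`p ∈ S` with `p.1 ≻ 0`. -/
theorem exists_posSemidef_multiplier {S : Set (Matrix ι ι 𝕜 × ℝ)} (hconv : Convex ℝ S)
    (hherm : ∀ p ∈ S, p.1.IsHermitian) (hslater : ∃ p ∈ S, p.1.PosDef)
    (hopt : ∀ p ∈ S, p.1.PosDef → p.2 ≤ 0) :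
    ∃ Z : Matrix ι ι 𝕜, Z.PosSemidef ∧ ∀ p ∈ S, RCLike.re (Z * p.1).trace + p.2 ≤ 0 := by
  classical
  obtain ⟨p₀, hp₀, hp₀pos⟩ := hslater
  let φ : Matrix ι ι 𝕜 × ℝ →ₗ[ℝ] Matrix (ι ⊕ Unit) (ι ⊕ Unit) 𝕜 :=
    { toFun := fun p => fromBlocks p.1 0 0 (p.2 • 1)
      map_add' := fun p q => by simp [fromBlocks_add, add_smul]
      map_smul' := fun a p => by simp [fromBlocks_smul, smul_smul] }
  have hφ : ∀ p ∈ S, ¬ (φ p).PosDef := fun p hp hpos => by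
    have hpos₂ : 0 < p.2 • (1 : 𝕜) := by simpa [φ] using hpos.diag_pos (i := Sum.inr ())
    rw [RCLike.pos_iff, RCLike.smul_re, RCLike.one_re, mul_one] at hpos₂
    exact (hopt p hp (hpos.submatrix Sum.inl_injective)).not_gt hpos₂.1
  obtain ⟨Z, hZ, hZ0, hZS⟩ := exists_posSemidef_of_forall_not_posDef (S := φ '' S)
    ⟨_, p₀, hp₀, rfl⟩ (hconv.linear_image φ)
    (Set.forall_mem_image.2 fun p hp =>
      (hherm p hp).fromBlocks (by simp) (isHermitian_one.smul (IsSelfAdjoint.all _)))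
    (Set.forall_mem_image.2 hφ)
  set c := RCLike.re Z.toBlocks₂₂.trace with hc
  have hZ₁ : Z.toBlocks₁₁.PosSemidef := hZ.submatrix Sum.inl
  have hZS' (p) (hp : p ∈ S) : RCLike.re (Z.toBlocks₁₁ * p.1).trace + c * p.2 ≤ 0 := by
    have := hZS _ ⟨p, hp, rfl⟩
    change RCLike.re (Z * fromBlocks p.1 0 0 (p.2 • 1)).trace ≤ 0 at this
    rwa [trace_mul_fromBlocks_zero_zero, map_add, Matrix.mul_smul, Matrix.mul_one, trace_smul,
      RCLike.smul_re, ← hc, mul_comm p.2] at this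
  have hcpos : 0 < c := by
    have hnonneg : 0 ≤ c :=
      (RCLike.nonneg_iff.1 (hZ.submatrix (Sum.inr : Unit → ι ⊕ Unit)).trace_nonneg).1
    refine hnonneg.lt_of_ne' fun hzero => hZ0 (eq_zero_of_re_trace_mul_nonpos hZ .one ?_)
    have hZ₁0 : Z.toBlocks₁₁ = 0 := eq_zero_of_re_trace_mul_nonpos hZ₁ hp₀pos <| by
      simpa [hzero] using hZS' p₀ hp₀
    rw [← fromBlocks_one, trace_mul_fromBlocks_zero_zero, hZ₁0]
    simp [← hc, hzero]
  refine ⟨c⁻¹ • Z.toBlocks₁₁, hZ₁.smul (inv_nonneg.2 hcpos.le), fun p hp => ?_⟩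
  rw [smul_mul_assoc, trace_smul, RCLike.smul_re]
  calc c⁻¹ * RCLike.re (Z.toBlocks₁₁ * p.1).trace + p.2
      = c⁻¹ * (RCLike.re (Z.toBlocks₁₁ * p.1).trace + c * p.2) := by field_simp
    _ ≤ 0 := mul_nonpos_of_nonneg_of_nonpos (inv_nonneg.2 hcpos.le) (hZS' p hp)

end Alternatives

section Projection

open Matrix

variable {𝕜 : Type*} [RCLike 𝕜] {ι κ μ : Type*} [Fintype ι] [Fintype κ] [Fintype μ]

theorem exists_isStarProjection_mul_eq_self (G : Matrix κ ι 𝕜) :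
    ∃ X : Matrix κ ι 𝕜, IsStarProjection (Gᴴ * X) ∧ G * (Gᴴ * X) = G := by
  classical
  have hrange : LinearMap.range (G * Gᴴ).mulVecLin = LinearMap.range G.mulVecLin :=
    Submodule.eq_of_le_of_finrank_eq
      (by rw [mulVecLin_mul]; exact LinearMap.range_comp_le_range _ _)
      (rank_self_mul_conjTranspose G)
  have hcol : ∀ j, ∃ v, (G * Gᴴ) *ᵥ v = G.col j := fun j => by
    have : G.col j ∈ LinearMap.range (G * Gᴴ).mulVecLin := hrange ▸ ⟨Pi.single j 1, by simp⟩
    exact this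
  choose v hv using hcol
  let X : Matrix κ ι 𝕜 := of fun i j => v j i
  have hfix : G * (Gᴴ * X) = G := by
    rw [← Matrix.mul_assoc]
    ext i j
    exact congrFun (hv j) i
  have hstar : (Gᴴ * X)ᴴ * (Gᴴ * X) = (Gᴴ * X)ᴴ := by
    rw [conjTranspose_mul, conjTranspose_conjTranspose, Matrix.mul_assoc, hfix]
  have hherm : (Gᴴ * X)ᴴ = Gᴴ * X := by
    have := congrArg conjTranspose hstar
    rwa [conjTranspose_mul, conjTranspose_conjTranspose, hstar] at this
  exact ⟨X, ⟨by rwa [hherm] at hstar, hherm⟩, hfix⟩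

theorem eq_zero_of_forall_mul_re_trace_le {M : Matrix ι κ 𝕜} {c : ℝ}
    (h : ∀ s : ℝ, s * RCLike.re (M * Mᴴ).trace ≤ c) : M = 0 := by
  classical
  obtain ⟨-, him⟩ := RCLike.nonneg_iff.1 (posSemidef_self_mul_conjTranspose M).trace_nonneg
  refine trace_mul_conjTranspose_self_eq_zero_iff.1 (RCLike.ext ?_ (by simpa using him))
  by_contra hne
  rw [map_zero] at hne
  have := h ((c + 1) / RCLike.re (M * Mᴴ).trace)
  rw [div_mul_cancel₀ _ hne] at this
  linarith

theorem exists_eq_add_of_mul_mul_eq_zero {κ μ : Type*} [Finite μ] {Z : Matrix ι ι 𝕜}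
    (hZ : Z.PosSemidef) {U : Matrix ι κ 𝕜} {V : Matrix μ ι 𝕜} (hVZU : V * Z * U = 0) :
    ∃ F₁ F₂ : Matrix ι ι 𝕜, Z = F₁ * F₁ᴴ + F₂ * F₂ᴴ ∧ Uᴴ * F₁ = 0 ∧ V * F₂ = 0 := by
  classical
  have := Fintype.ofFinite μ
  obtain ⟨B, rfl⟩ := exists_eq_conjTranspose_mul_self_of_posSemidef hZ le_rfl
  obtain ⟨X, hproj, hfix⟩ := exists_isStarProjection_mul_eq_self (V * Bᴴ)
  have hsplit : ∀ {R : Matrix ι ι 𝕜}, IsStarProjection R → Bᴴ * R * (Bᴴ * R)ᴴ = Bᴴ * R * B := by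
    intro R hR
    rw [conjTranspose_mul, conjTranspose_conjTranspose, ← star_eq_conjTranspose R,
      hR.isSelfAdjoint.star_eq, Matrix.mul_assoc, ← Matrix.mul_assoc R, hR.isIdempotentElem.eq,
      ← Matrix.mul_assoc]
  refine ⟨Bᴴ * ((V * Bᴴ)ᴴ * X), Bᴴ * (1 - (V * Bᴴ)ᴴ * X), ?_, ?_, ?_⟩
  · rw [hsplit hproj, hsplit hproj.one_sub, ← Matrix.add_mul, ← Matrix.mul_add, add_sub_cancel,
      Matrix.mul_one]
  · calc Uᴴ * (Bᴴ * ((V * Bᴴ)ᴴ * X)) = (V * (Bᴴ * B) * U)ᴴ * X := by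
          simp only [conjTranspose_mul, conjTranspose_conjTranspose, Matrix.mul_assoc]
      _ = 0 := by rw [hVZU, conjTranspose_zero, Matrix.zero_mul]
  · rw [← Matrix.mul_assoc, Matrix.mul_sub, Matrix.mul_one, hfix, sub_self]

theorem PosDefOnKer.eq_zero_of_mul_mul_eq_zero {κ μ : Type*} [Finite μ] {H Z : Matrix ι ι 𝕜}
    {U : Matrix ι κ 𝕜} {V : Matrix μ ι 𝕜} (hU : PosDefOnKer H Uᴴ) (hV : PosDefOnKer H V)
    (hZ : Z.PosSemidef) (hVZU : V * Z * U = 0) (hZH : RCLike.re (Z * H).trace ≤ 0) : Z = 0 := by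
  obtain ⟨F₁, F₂, rfl, hUF, hVF⟩ := exists_eq_add_of_mul_mul_eq_zero hZ hVZU
  have hsum : RCLike.re ((F₁ * F₁ᴴ + F₂ * F₂ᴴ) * H).trace =
      RCLike.re (F₁ᴴ * H * F₁).trace + RCLike.re (F₂ᴴ * H * F₂).trace := by
    rw [Matrix.add_mul, trace_add, map_add, Matrix.mul_assoc F₁, trace_mul_comm F₁,
      Matrix.mul_assoc F₂, trace_mul_comm F₂]
  have h₁ := hU.re_trace_nonneg hUF
  have h₂ := hV.re_trace_nonneg hVF
  rw [hU.eq_zero_of_re_trace_nonpos hUF (by linarith),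
    hV.eq_zero_of_re_trace_nonpos hVF (by linarith)]
  simp

theorem posDefOnKer_of_posDef_add {H : Matrix ι ι 𝕜} {U : Matrix ι κ 𝕜} {Θ : Matrix κ μ 𝕜}
    {V : Matrix μ ι 𝕜} (h : (H + (U * Θ * V + (U * Θ * V)ᴴ)).PosDef) :
    PosDefOnKer H Uᴴ ∧ PosDefOnKer H V := by
  have key : ∀ x, reInner x ((H + (U * Θ * V + (U * Θ * V)ᴴ)) *ᵥ x) =
      reInner x (H *ᵥ x) + 2 * reInner (Uᴴ *ᵥ x) (Θ *ᵥ V *ᵥ x) := fun x => by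
    have hadj : reInner x ((U * Θ * V)ᴴ *ᵥ x) = reInner x ((U * Θ * V) *ᵥ x) := by
      rw [reInner_mulVec, conjTranspose_conjTranspose, reInner_comm]
    rw [add_mulVec, add_mulVec, map_add, map_add, hadj, ← mulVec_mulVec, ← mulVec_mulVec,
      reInner_mulVec x U]
    ring
  have hpos := (posDef_iff_reInner_pos.1 h).2
  constructor <;>
  · intro x hx hker
    have := hpos x hx
    rw [key, hker] at this
    simpa using this

/-- The projection lemma. If no `Θ` works, the convex family of candidates is separated from the
positive definite matrices by some `Z ≽ 0`; as `Θ` is unconstrained, `V Z U = 0`, so `Z` splits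
into a part living on `ker Uᴴ` and a part living on `ker V`. -/
theorem exists_posDef_add_iff {H : Matrix ι ι 𝕜} (hH : H.IsHermitian) (U : Matrix ι κ 𝕜)
    (V : Matrix μ ι 𝕜) :
    (∃ Θ : Matrix κ μ 𝕜, (H + (U * Θ * V + (U * Θ * V)ᴴ)).PosDef) ↔
      PosDefOnKer H Uᴴ ∧ PosDefOnKer H V := by
  refine ⟨fun ⟨Θ, hΘ⟩ => posDefOnKer_of_posDef_add hΘ, fun ⟨hU, hV⟩ => ?_⟩
  by_contra! hno
  obtain ⟨Z, hZ, hZ0, hsep⟩ := exists_posSemidef_of_forall_not_posDef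
    (S := Set.range fun Θ : Matrix κ μ 𝕜 => H + (U * Θ * V + (U * Θ * V)ᴴ))
    (Set.range_nonempty _)
    (by
      rintro _ ⟨Θ, rfl⟩ _ ⟨Θ', rfl⟩ a b - - hab
      refine ⟨a • Θ + b • Θ', ?_⟩
      have hHab : H = a • H + b • H := by rw [← add_smul, hab, one_smul]
      simp only [Matrix.mul_add, Matrix.add_mul, Matrix.mul_smul, Matrix.smul_mul,
        conjTranspose_add, conjTranspose_smul, star_trivial, smul_add]
      nth_rewrite 1 [hHab]
      abel)
    (by rintro _ ⟨Θ, rfl⟩; exact hH.add (isHermitian_add_transpose_self _))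
    (by rintro _ ⟨Θ, rfl⟩; exact hno Θ)
  have haffine : ∀ Θ : Matrix κ μ 𝕜,
      RCLike.re (Z * H).trace + 2 * RCLike.re (V * Z * U * Θ).trace ≤ 0 := fun Θ => by
    have hcycle : (Z * (U * Θ * V)).trace = (V * Z * U * Θ).trace := by
      rw [← Matrix.mul_assoc, trace_mul_comm]
      simp only [Matrix.mul_assoc]
    have := hsep _ ⟨Θ, rfl⟩
    simp only [Matrix.mul_add, trace_add, map_add,
      re_trace_mul_conjTranspose_of_isHermitian hZ.isHermitian, hcycle] at this
    linarith
  have hVZU : V * Z * U = 0 := by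
    refine eq_zero_of_forall_mul_re_trace_le (c := -RCLike.re (Z * H).trace / 2) fun s => ?_
    have := haffine (s • (V * Z * U)ᴴ)
    rw [Matrix.mul_smul, trace_smul, RCLike.smul_re] at this
    linarith
  exact hZ0 (hU.eq_zero_of_mul_mul_eq_zero hV hZ hVZU (by simpa using haffine 0))

end Projection

section Dissipation

open Matrix

variable {𝕜 : Type*} [RCLike 𝕜] {n ν m r p q : Type*} [Fintype n] [Fintype ν] [Fintype r]
  [Fintype q]

/-- The matrix `[A B; C D]` of a system. -/
def StateSpace.toMatrix (S : StateSpace 𝕜 n m p) : Matrix (n ⊕ p) (n ⊕ m) 𝕜 :=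
  fromBlocks S.A S.B S.C S.D

/-- The matrix of `xᴴ P x + wᴴ L w - x⁺ᴴ P x⁺ - zᴴ M z` as a quadratic form in `(x, w)`: its
positivity says that the storage `xᴴ P x` grows by less than the supply `wᴴ L w - zᴴ M z`. -/
def dissipationMatrix [Fintype p] (S : StateSpace 𝕜 n m p) (P : Matrix n n 𝕜) (L : Matrix m m 𝕜)
    (M : Matrix p p 𝕜) : Matrix (n ⊕ m) (n ⊕ m) 𝕜 :=
  fromBlocks P 0 0 L - S.toMatrixᴴ * fromBlocks P 0 0 M * S.toMatrix

/-- The matrix inequality of the second semidefinite program, for a system `S`; it is linear in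
`S`, unlike `dissipationMatrix`. -/
def constructionMatrix [DecidableEq n] [DecidableEq p] (S : StateSpace 𝕜 n m p) (P : Matrix n n 𝕜)
    (L : Matrix m m 𝕜) : Matrix ((n ⊕ p) ⊕ (n ⊕ m)) ((n ⊕ p) ⊕ (n ⊕ m)) 𝕜 :=
  fromBlocks (fromBlocks P⁻¹ 0 0 1) S.toMatrix S.toMatrixᴴ (fromBlocks P 0 0 L)

theorem dissipationMatrix_eq_neg_fromBlocks [Fintype p] [DecidableEq p]
    (S : StateSpace 𝕜 n m p) (P : Matrix n n 𝕜) (L : Matrix m m 𝕜) :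
    dissipationMatrix S P L 1 =
      -(fromBlocks (S.Aᴴ * P * S.A - P) (S.Aᴴ * P * S.B) (S.Bᴴ * P * S.A) (S.Bᴴ * P * S.B - L) +
        fromBlocks (S.Cᴴ * S.C) (S.Cᴴ * S.D) (S.Dᴴ * S.C) (S.Dᴴ * S.D)) := by
  simp only [dissipationMatrix, StateSpace.toMatrix, fromBlocks_conjTranspose, fromBlocks_multiply,
    sub_eq_add_neg, fromBlocks_neg, fromBlocks_add, Matrix.mul_zero, Matrix.mul_one, zero_add,
    add_zero]
  congr 1 <;> abel

theorem isHermitian_real_smul_one [DecidableEq m] (lam : ℝ) :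
    (lam • (1 : Matrix m m 𝕜)).IsHermitian :=
  isHermitian_one.smul (IsSelfAdjoint.all lam)

theorem SparsityConstraints.isHermitian_smul_one_add [DecidableEq m] {Y : Matrix m m 𝕜}
    {lam t : ℝ} (h : SparsityConstraints Y lam t) : (lam • (1 : Matrix m m 𝕜) + Y).IsHermitian :=
  (isHermitian_real_smul_one lam).add h.isHermitian

theorem posDef_fromBlocks_zero_zero {ι κ : Type*} [Finite ι] [Finite κ] {M : Matrix ι ι 𝕜}
    {N : Matrix κ κ 𝕜} (hM : M.PosDef) (hN : N.PosDef) : (fromBlocks M 0 0 N).PosDef := by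
  classical
  have := Fintype.ofFinite ι
  simpa using (posDef_fromBlocks_iff₁₁ hM 0 N).2 (by simpa using hN)

theorem inv_fromBlocks_zero_zero_of_posDef {ι κ : Type*} [Fintype ι] [DecidableEq ι] [Fintype κ]
    [DecidableEq κ] {M : Matrix ι ι 𝕜} {N : Matrix κ κ 𝕜} (hM : M.PosDef) (hN : N.PosDef) :
    (fromBlocks M 0 0 N)⁻¹ = fromBlocks M⁻¹ 0 0 N⁻¹ := by
  simp [inv_fromBlocks_zero₂₁_of_isUnit_iff _ _ _ (iff_of_true hM.isUnit hN.isUnit)]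

theorem posDef_constructionMatrix_iff [DecidableEq n] [Finite m] [Fintype p] [DecidableEq p]
    (S : StateSpace 𝕜 n m p) {P : Matrix n n 𝕜} (hP : P.PosDef) (L : Matrix m m 𝕜) :
    (constructionMatrix S P L).PosDef ↔ (dissipationMatrix S P L 1).PosDef := by
  rw [constructionMatrix, posDef_fromBlocks_iff₁₁ (posDef_fromBlocks_zero_zero hP.inv .one),
    inv_fromBlocks_zero_zero_of_posDef hP.inv .one, nonsing_inv_inv_of_posDef hP, inv_one,
    dissipationMatrix]

theorem synthesisFeasible_iff [DecidableEq m] [Fintype p] [DecidableEq p]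
    {G : Plant 𝕜 n m r p q} {K : Controller 𝕜 ν r q} {Pcl : Matrix (n ⊕ ν) (n ⊕ ν) 𝕜}
    {Y : Matrix m m 𝕜} {lam t : ℝ} :
    SynthesisFeasible G K Pcl Y lam t ↔ SparsityConstraints Y lam t ∧ Pcl.PosDef ∧
      (dissipationMatrix (closedLoop G K) Pcl (lam • 1 + Y) 1).PosDef := by
  rw [dissipationMatrix_eq_neg_fromBlocks, ← sub_sub]
  exact ⟨fun h => ⟨h.sparsity, h.Pcl_posDef, h.lmi⟩, fun h => ⟨h.1, h.2.1, h.2.2⟩⟩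

theorem constructionFeasible_iff_posDef [DecidableEq n] [DecidableEq ν] [DecidableEq m]
    [DecidableEq p] {G : Plant 𝕜 n m r p q} {K : Controller 𝕜 ν r q}
    {Pcl : Matrix (n ⊕ ν) (n ⊕ ν) 𝕜} {Y : Matrix m m 𝕜} {lam t : ℝ} :
    ConstructionFeasible G Pcl K Y lam t ↔ SparsityConstraints Y lam t ∧
      (constructionMatrix (closedLoop G K) Pcl (lam • 1 + Y)).PosDef := by
  rw [constructionMatrix, StateSpace.toMatrix, fromBlocks_conjTranspose]
  exact ⟨fun h => ⟨h.sparsity, h.lmi⟩, fun h => ⟨h.1, h.2⟩⟩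

theorem constructionFeasible_iff_synthesisFeasible [DecidableEq n] [DecidableEq ν] [Finite m]
    [DecidableEq m] [Fintype p] [DecidableEq p] {G : Plant 𝕜 n m r p q} {K : Controller 𝕜 ν r q}
    {Pcl : Matrix (n ⊕ ν) (n ⊕ ν) 𝕜} (hPcl : Pcl.PosDef) {Y : Matrix m m 𝕜} {lam t : ℝ} :
    ConstructionFeasible G Pcl K Y lam t ↔ SynthesisFeasible G K Pcl Y lam t := by
  rw [constructionFeasible_iff_posDef, synthesisFeasible_iff, posDef_constructionMatrix_iff _ hPcl,
    and_iff_right hPcl]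

end Dissipation

section Elimination

open Matrix

variable {𝕜 : Type*} [RCLike 𝕜] {n ν m r p q : Type*}

theorem posDefOnKer_fromBlocks_fromCols_iff {ι κ μ : Type*} [Fintype ι] [Fintype κ]
    {A : Matrix ι ι 𝕜} {B : Matrix ι κ 𝕜} {C : Matrix κ ι 𝕜} {D : Matrix κ κ 𝕜}
    {L : Matrix μ ι 𝕜} {M : Matrix μ κ 𝕜} :
    PosDefOnKer (fromBlocks A B C D) (fromCols L M) ↔
      ∀ x y, ¬(x = 0 ∧ y = 0) → L *ᵥ x + M *ᵥ y = 0 →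
        0 < reInner x (A *ᵥ x + B *ᵥ y) + reInner y (C *ᵥ x + D *ᵥ y) := by
  have hzero : ∀ (x : ι → 𝕜) (y : κ → 𝕜), Sum.elim x y = 0 ↔ x = 0 ∧ y = 0 := fun x y => by
    simp [funext_iff]
  rw [PosDefOnKer, (Equiv.sumArrowEquivProdArrow ι κ 𝕜).forall_congr_left, Prod.forall]
  refine forall₂_congr fun x y => ?_
  change Sum.elim x y ≠ 0 → _ *ᵥ Sum.elim x y = 0 →
    0 < reInner (Sum.elim x y) (_ *ᵥ Sum.elim x y) ↔ _
  rw [Ne, hzero, fromCols_mulVec_sumElim, fromBlocks_mulVec, reInner_sumElim, Sum.elim_comp_inl,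
    Sum.elim_comp_inr]

theorem posDefOnKer_fromBlocks_swap {ι κ μ : Type*} [Fintype ι] [Fintype κ] (A : Matrix ι ι 𝕜)
    (B : Matrix ι κ 𝕜) (C : Matrix κ ι 𝕜) (D : Matrix κ κ 𝕜) (L : Matrix μ ι 𝕜)
    (M : Matrix μ κ 𝕜) :
    PosDefOnKer (fromBlocks A B C D) (fromCols L M) ↔
      PosDefOnKer (fromBlocks D C B A) (fromCols M L) := by
  rw [posDefOnKer_fromBlocks_fromCols_iff, posDefOnKer_fromBlocks_fromCols_iff, forall_comm]
  refine forall₂_congr fun y x => ?_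
  rw [and_comm, add_comm (L *ᵥ x), add_comm (reInner x _), add_comm (C *ᵥ x), add_comm (A *ᵥ x)]

theorem posDefOnKer_fromBlocks_iff₁₁ {ι κ μ : Type*} [Fintype ι] [Fintype κ] [DecidableEq ι]
    {A : Matrix ι ι 𝕜} (hA : A.PosDef) (B : Matrix ι κ 𝕜) (D : Matrix κ κ 𝕜) (L : Matrix μ κ 𝕜) :
    PosDefOnKer (fromBlocks A B Bᴴ D) (fromCols 0 L) ↔ PosDefOnKer (D - Bᴴ * A⁻¹ * B) L := by
  have hform : ∀ x y, reInner x (A *ᵥ x + B *ᵥ y) + reInner y (Bᴴ *ᵥ x + D *ᵥ y) =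
      reInner x (A *ᵥ x) + 2 * reInner (B *ᵥ y) x + reInner y (D *ᵥ y) := fun x y => by
    rw [map_add, map_add, reInner_mulVec y Bᴴ, conjTranspose_conjTranspose,
      reInner_comm x (B *ᵥ y)]
    ring
  have hschur : ∀ y, (∀ x, 0 < reInner x (A *ᵥ x) + 2 * reInner (B *ᵥ y) x + reInner y (D *ᵥ y)) ↔
      0 < reInner y ((D - Bᴴ * A⁻¹ * B) *ᵥ y) := fun y => by
    rw [forall_reInner_mulVec_add_pos_iff hA, sub_mulVec, map_sub, reInner_conj_mulVec, sub_pos]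
  simp only [posDefOnKer_fromBlocks_fromCols_iff, hform, zero_mulVec, zero_add]
  refine ⟨fun h y hy hL => (hschur y).1 fun x => h x y (fun h0 => hy h0.2) hL,
    fun h x y hxy hL => ?_⟩
  by_cases hy : y = 0
  · subst hy
    simpa using (posDef_iff_reInner_pos.1 hA).2 x fun hx => hxy ⟨hx, rfl⟩
  · exact (hschur y).2 (h y hy hL) x

/-- The adjoint plant, which exchanges the roles of control and measurement. -/
def Plant.dual (G : Plant 𝕜 n m r p q) : Plant 𝕜 n p q m r where
  A := G.Aᴴ
  B₁ := G.C₁ᴴ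
  B₂ := G.C₂ᴴ
  C₁ := G.B₁ᴴ
  D₁₁ := G.D₁₁ᴴ
  D₁₂ := G.D₂₁ᴴ
  C₂ := G.B₂ᴴ
  D₂₁ := G.D₁₂ᴴ

/-- The plant without control and measurement. -/
def Plant.toStateSpace (G : Plant 𝕜 n m r p q) : StateSpace 𝕜 n m p :=
  ⟨G.A, G.B₁, G.C₁, G.D₁₁⟩

/-- The plant without control, its state extended by a controller state with `ζ⁺ = 0`: the matrix
of the closed loop is an affine function of the controller matrix with this constant term. -/
def openLoop (ν : Type*) (G : Plant 𝕜 n m r p q) : StateSpace 𝕜 (n ⊕ ν) m p where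
  A := fromBlocks G.A 0 0 0
  B := fromRows G.B₁ 0
  C := fromCols G.C₁ 0
  D := G.D₁₁

/-- The matrix `[A_K B_K; C_K D_K]` of a controller. -/
def Controller.toMatrix (K : Controller 𝕜 ν r q) : Matrix (ν ⊕ r) (ν ⊕ q) 𝕜 :=
  fromBlocks K.AK K.BK K.CK K.DK

/-- The matrix that sends `(x, ζ, w)` to the input `(ζ, y)` of the controller. -/
def measurementMatrix (ν : Type*) [DecidableEq ν] (G : Plant 𝕜 n m r p q) :
    Matrix (ν ⊕ q) ((n ⊕ ν) ⊕ m) 𝕜 :=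
  fromCols (fromBlocks 0 1 G.C₂ 0) (fromRows 0 G.D₂₁)

theorem toMatrix_closedLoop [Fintype ν] [DecidableEq ν] [Fintype r] [Fintype q]
    (G : Plant 𝕜 n m r p q) (K : Controller 𝕜 ν r q) :
    (closedLoop G K).toMatrix = (openLoop ν G).toMatrix +
      (measurementMatrix ν G.dual)ᴴ * K.toMatrix * measurementMatrix ν G := by
  simp only [StateSpace.toMatrix, closedLoop, openLoop, measurementMatrix, Plant.dual,
    Controller.toMatrix, conjTranspose_fromCols_eq_fromRows_conjTranspose,
    conjTranspose_fromRows_eq_fromCols_conjTranspose, fromBlocks_conjTranspose, fromRows_mul,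
    mul_fromCols, fromBlocks_multiply, fromCols_mul_fromBlocks]
  ext ((i | i) | i) ((j | j) | j) <;>
    simp [Matrix.mul_assoc, fromCols_mul_fromRows, fromBlocks_mul_fromRows]

theorem constructionMatrix_closedLoop [Fintype n] [DecidableEq n] [Fintype ν] [DecidableEq ν]
    [Fintype r] [DecidableEq p] [Fintype q] (G : Plant 𝕜 n m r p q) (K : Controller 𝕜 ν r q)
    (Pcl : Matrix (n ⊕ ν) (n ⊕ ν) 𝕜) (L : Matrix m m 𝕜) :
    let U := (fromCols (measurementMatrix ν G.dual) (0 : Matrix _ ((n ⊕ ν) ⊕ m) 𝕜))ᴴ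
    let V := fromCols (0 : Matrix _ ((n ⊕ ν) ⊕ p) 𝕜) (measurementMatrix ν G)
    constructionMatrix (closedLoop G K) Pcl L = constructionMatrix (openLoop ν G) Pcl L +
      (U * K.toMatrix * V + (U * K.toMatrix * V)ᴴ) := by
  intro U V
  have hUV : U * K.toMatrix * V = fromBlocks 0
      ((measurementMatrix ν G.dual)ᴴ * K.toMatrix * measurementMatrix ν G) 0 0 := by
    simp only [U, V]
    rw [conjTranspose_fromCols_eq_fromRows_conjTranspose, fromRows_mul, conjTranspose_zero,
      fromRows_mul_fromCols, Matrix.mul_zero, Matrix.zero_mul, Matrix.zero_mul, Matrix.zero_mul]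
  rw [hUV, constructionMatrix, toMatrix_closedLoop, constructionMatrix]
  simp [fromBlocks_conjTranspose, fromBlocks_add]

theorem posDefOnKer_iff_conj {ι κ μ ρ : Type*} [Fintype ι] [Fintype κ] {E : Matrix ι κ 𝕜}
    {L : Matrix μ ι 𝕜} {M : Matrix ρ κ 𝕜} (hinj : ∀ y, E *ᵥ y = 0 → y = 0)
    (hker : ∀ x, L *ᵥ x = 0 ↔ ∃ y, M *ᵥ y = 0 ∧ E *ᵥ y = x) (H : Matrix ι ι 𝕜) :
    PosDefOnKer H L ↔ PosDefOnKer (Eᴴ * H * E) M := by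
  refine ⟨fun h y hy hMy => ?_, fun h x hx hLx => ?_⟩
  · rw [reInner_conj_mulVec]
    exact h _ (mt (hinj y) hy) ((hker _).2 ⟨y, hMy, rfl⟩)
  · obtain ⟨y, hMy, rfl⟩ := (hker x).1 hLx
    rw [← reInner_conj_mulVec]
    exact h y (fun hy => hx (by rw [hy, mulVec_zero])) hMy

theorem IsOrthonormalKernelBasis.posDef_iff {ι κ μ : Type*} [Fintype ι] [Fintype κ] [DecidableEq κ]
    {L : Matrix μ ι 𝕜} {N : Matrix ι κ 𝕜} (hN : IsOrthonormalKernelBasis L N) {H : Matrix ι ι 𝕜}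
    (hH : H.IsHermitian) : (Nᴴ * H * N).PosDef ↔ PosDefOnKer H L := by
  have hinj : ∀ v, N *ᵥ v = 0 → v = 0 := fun v hv => by
    rw [← one_mulVec v, ← hN.orthonormal, ← mulVec_mulVec, hv, mulVec_zero]
  rw [posDefOnKer_iff_conj (M := (0 : Matrix κ κ 𝕜)) hinj (fun x => by
      simpa using (SetLike.ext_iff.1 hN.range_eq_ker x).symm), posDef_iff_reInner_pos,
    and_iff_right (isHermitian_conjTranspose_mul_mul _ hH)]
  simp [PosDefOnKer]

/-- The embedding `(x, w) ↦ ((x, 0), w)`. -/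
def zeroStateEmbedding (𝕜 n ν m : Type*) [RCLike 𝕜] [DecidableEq n] [DecidableEq m] :
    Matrix ((n ⊕ ν) ⊕ m) (n ⊕ m) 𝕜 :=
  fromBlocks (fromRows 1 0) 0 0 1

theorem conj_zeroStateEmbedding [Fintype n] [DecidableEq n] [Fintype ν] [Fintype m] [DecidableEq m]
    (P : Matrix (n ⊕ ν) (n ⊕ ν) 𝕜) (L : Matrix m m 𝕜) :
    (zeroStateEmbedding 𝕜 n ν m)ᴴ * fromBlocks P 0 0 L * zeroStateEmbedding 𝕜 n ν m =
      fromBlocks P.toBlocks₁₁ 0 0 L := by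
  rw [← fromBlocks_toBlocks P]
  simp [zeroStateEmbedding, fromBlocks_conjTranspose, fromBlocks_multiply,
    conjTranspose_fromRows_eq_fromCols_conjTranspose, fromCols_mul_fromBlocks,
    fromCols_mul_fromRows]

theorem toMatrix_openLoop_mul_zeroStateEmbedding [Fintype n] [DecidableEq n] [Fintype ν]
    [Fintype m] [DecidableEq m] [Fintype p] [DecidableEq p] (G : Plant 𝕜 n m r p q) :
    (openLoop ν G).toMatrix * zeroStateEmbedding 𝕜 n ν m =
      zeroStateEmbedding 𝕜 n ν p * G.toStateSpace.toMatrix := by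
  simp [openLoop, zeroStateEmbedding, StateSpace.toMatrix, Plant.toStateSpace, fromBlocks_multiply,
    fromRows_mul, fromCols_mul_fromRows, fromBlocks_mul_fromRows]

theorem conj_dissipationMatrix_openLoop [Fintype n] [DecidableEq n] [Fintype ν] [Fintype m]
    [DecidableEq m] [Fintype p] (G : Plant 𝕜 n m r p q)
    (P : Matrix (n ⊕ ν) (n ⊕ ν) 𝕜) (L : Matrix m m 𝕜) (M : Matrix p p 𝕜) :
    (zeroStateEmbedding 𝕜 n ν m)ᴴ * dissipationMatrix (openLoop ν G) P L M *
      zeroStateEmbedding 𝕜 n ν m = dissipationMatrix G.toStateSpace P.toBlocks₁₁ L M := by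
  classical
  have hout : (zeroStateEmbedding 𝕜 n ν m)ᴴ *
      ((openLoop ν G).toMatrixᴴ * fromBlocks P 0 0 M * (openLoop ν G).toMatrix) *
        zeroStateEmbedding 𝕜 n ν m =
      G.toStateSpace.toMatrixᴴ * ((zeroStateEmbedding 𝕜 n ν p)ᴴ * fromBlocks P 0 0 M *
        zeroStateEmbedding 𝕜 n ν p) * G.toStateSpace.toMatrix := by
    have := congrArg conjTranspose (toMatrix_openLoop_mul_zeroStateEmbedding (ν := ν) G)
    rw [conjTranspose_mul, conjTranspose_mul] at this
    simp only [← Matrix.mul_assoc, this]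
    simp only [Matrix.mul_assoc, toMatrix_openLoop_mul_zeroStateEmbedding]
  rw [dissipationMatrix, Matrix.mul_sub, Matrix.sub_mul, conj_zeroStateEmbedding, hout,
    conj_zeroStateEmbedding, dissipationMatrix]

theorem posDefOnKer_dissipationMatrix_openLoop_iff [Fintype n] [Fintype ν]
    [DecidableEq ν] [Fintype m] [Fintype p] (G : Plant 𝕜 n m r p q)
    (P : Matrix (n ⊕ ν) (n ⊕ ν) 𝕜) (L : Matrix m m 𝕜) (M : Matrix p p 𝕜) :
    PosDefOnKer (dissipationMatrix (openLoop ν G) P L M) (measurementMatrix ν G) ↔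
      PosDefOnKer (dissipationMatrix G.toStateSpace P.toBlocks₁₁ L M) (fromCols G.C₂ G.D₂₁) := by
  classical
  have hE : ∀ x w, zeroStateEmbedding 𝕜 n ν m *ᵥ Sum.elim x w = Sum.elim (Sum.elim x 0) w :=
    fun x w => by simp [zeroStateEmbedding, fromBlocks_mulVec, fromRows_mulVec]
  have hmeas : ∀ x ζ w, measurementMatrix ν G *ᵥ Sum.elim (Sum.elim x ζ) w =
      Sum.elim ζ (G.C₂ *ᵥ x + G.D₂₁ *ᵥ w) := fun x ζ w => by
    ext (i | i) <;> simp [measurementMatrix, fromBlocks_mulVec, fromRows_mulVec]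
  have hinv : (zeroStateEmbedding 𝕜 n ν m)ᴴ * zeroStateEmbedding 𝕜 n ν m = 1 := by
    have h := conj_zeroStateEmbedding (fromBlocks (1 : Matrix n n 𝕜) 0 0 (1 : Matrix ν ν 𝕜))
      (1 : Matrix m m 𝕜)
    rwa [toBlocks_fromBlocks₁₁, fromBlocks_one, fromBlocks_one, fromBlocks_one,
      Matrix.mul_one] at h
  rw [← conj_dissipationMatrix_openLoop]
  refine posDefOnKer_iff_conj (fun y hy => ?_) (fun v => ⟨fun hv => ?_, ?_⟩) _
  · rw [← one_mulVec y, ← hinv, ← mulVec_mulVec, hy, mulVec_zero]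
  · obtain ⟨x, ζ, w, rfl⟩ : ∃ x ζ w, v = Sum.elim (Sum.elim x ζ) w :=
      ⟨_, _, _, by rw [Sum.elim_comp_inl_inr, Sum.elim_comp_inl_inr]⟩
    rw [hmeas] at hv
    obtain rfl : ζ = 0 := congrArg (· ∘ Sum.inl) hv
    exact ⟨Sum.elim x w, by
      rw [fromCols_mulVec_sumElim]; exact congrArg (· ∘ Sum.inr) hv, hE x w⟩
  · rintro ⟨y, hy, rfl⟩
    obtain ⟨x, w, rfl⟩ : ∃ x w, y = Sum.elim x w := ⟨_, _, (Sum.elim_comp_inl_inr y).symm⟩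
    rw [fromCols_mulVec_sumElim] at hy
    rw [hE, hmeas, hy, Sum.elim_zero_zero]

theorem toMatrix_openLoop_dual (G : Plant 𝕜 n m r p q) :
    (openLoop ν G.dual).toMatrix = (openLoop ν G).toMatrixᴴ := by
  simp [openLoop, Plant.dual, StateSpace.toMatrix, fromBlocks_conjTranspose,
    conjTranspose_fromCols_eq_fromRows_conjTranspose,
    conjTranspose_fromRows_eq_fromCols_conjTranspose]

theorem exists_posDef_constructionMatrix_iff [Fintype n] [DecidableEq n] [Fintype ν]
    [DecidableEq ν] [Fintype m] [DecidableEq m] [Fintype r] [Fintype p] [DecidableEq p] [Fintype q]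
    (G : Plant 𝕜 n m r p q) {Pcl : Matrix (n ⊕ ν) (n ⊕ ν) 𝕜} (hPcl : Pcl.PosDef)
    {L : Matrix m m 𝕜} (hL : L.PosDef) :
    (∃ K : Controller 𝕜 ν r q, (constructionMatrix (closedLoop G K) Pcl L).PosDef) ↔
      PosDefOnKer (dissipationMatrix G.dual.toStateSpace Pcl⁻¹.toBlocks₁₁ 1 L⁻¹)
          (fromCols G.dual.C₂ G.dual.D₂₁) ∧
        PosDefOnKer (dissipationMatrix G.toStateSpace Pcl.toBlocks₁₁ L 1)
          (fromCols G.C₂ G.D₂₁) := by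
  have hout := posDef_fromBlocks_zero_zero hPcl.inv (PosDef.one (n := p) (R := 𝕜))
  have hin := posDef_fromBlocks_zero_zero hPcl hL
  have hmeasure : PosDefOnKer (constructionMatrix (openLoop ν G) Pcl L)
      (fromCols 0 (measurementMatrix ν G)) ↔
        PosDefOnKer (dissipationMatrix (openLoop ν G) Pcl L 1) (measurementMatrix ν G) := by
    rw [constructionMatrix, posDefOnKer_fromBlocks_iff₁₁ hout,
      inv_fromBlocks_zero_zero_of_posDef hPcl.inv PosDef.one, nonsing_inv_inv_of_posDef hPcl,
      inv_one, dissipationMatrix]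
  have hcontrol : PosDefOnKer (constructionMatrix (openLoop ν G) Pcl L)
      (fromCols (measurementMatrix ν G.dual) 0) ↔
        PosDefOnKer (dissipationMatrix (openLoop ν G.dual) Pcl⁻¹ 1 L⁻¹)
          (measurementMatrix ν G.dual) := by
    have h := posDefOnKer_fromBlocks_iff₁₁ hin (openLoop ν G).toMatrixᴴ (fromBlocks Pcl⁻¹ 0 0 1)
      (measurementMatrix ν G.dual)
    rw [inv_fromBlocks_zero_zero_of_posDef hPcl hL, conjTranspose_conjTranspose] at h
    rw [constructionMatrix, posDefOnKer_fromBlocks_swap, h, dissipationMatrix,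
      toMatrix_openLoop_dual, conjTranspose_conjTranspose]
  have hherm : (constructionMatrix (openLoop ν G) Pcl L).IsHermitian :=
    hout.isHermitian.fromBlocks rfl hin.isHermitian
  rw [← posDefOnKer_dissipationMatrix_openLoop_iff, ← posDefOnKer_dissipationMatrix_openLoop_iff,
    ← hmeasure, ← hcontrol, ← conjTranspose_conjTranspose (fromCols (measurementMatrix ν G.dual) 0),
    ← exists_posDef_add_iff hherm]
  refine ⟨fun ⟨K, hK⟩ => ⟨K.toMatrix, constructionMatrix_closedLoop G K Pcl L ▸ hK⟩,
    fun ⟨Θ, hΘ⟩ => ⟨⟨Θ.toBlocks₁₁, Θ.toBlocks₁₂, Θ.toBlocks₂₁, Θ.toBlocks₂₂⟩, ?_⟩⟩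
  rwa [constructionMatrix_closedLoop, Controller.toMatrix, fromBlocks_toBlocks]

theorem IsOrthonormalKernelBasis.posDef_lmi_iff {c : Type*} [Fintype n] [Fintype m] [Fintype p]
    [DecidableEq p] [Fintype c] [DecidableEq c] (G : Plant 𝕜 n m r p q)
    {N : Matrix (n ⊕ m) c 𝕜} (hN : IsOrthonormalKernelBasis (fromCols G.C₂ G.D₂₁) N)
    {P : Matrix n n 𝕜} (hP : P.IsHermitian) {L : Matrix m m 𝕜} (hL : L.IsHermitian)
    {M : Matrix p p 𝕜} (hM : M.PosDef) :
    (-((fromBlocks N 0 0 (1 : Matrix p p 𝕜))ᴴ * fromBlocks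
        (fromBlocks (G.Aᴴ * P * G.A - P) (G.Aᴴ * P * G.B₁)
          (G.B₁ᴴ * P * G.A) (G.B₁ᴴ * P * G.B₁ - L))
        (fromRows G.C₁ᴴ G.D₁₁ᴴ) (fromCols G.C₁ G.D₁₁) (-M) *
        fromBlocks N 0 0 (1 : Matrix p p 𝕜))).PosDef ↔
      PosDefOnKer (dissipationMatrix G.toStateSpace P L M⁻¹) (fromCols G.C₂ G.D₂₁) := by
  set F := fromBlocks (G.Aᴴ * P * G.A - P) (G.Aᴴ * P * G.B₁)
    (G.B₁ᴴ * P * G.A) (G.B₁ᴴ * P * G.B₁ - L) with hF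
  set C := fromCols G.C₁ G.D₁₁ with hC
  have hCstar : fromRows G.C₁ᴴ G.D₁₁ᴴ = Cᴴ :=
    (conjTranspose_fromCols_eq_fromRows_conjTranspose _ _).symm
  have hlmi : -((fromBlocks N 0 0 (1 : Matrix p p 𝕜))ᴴ * fromBlocks F Cᴴ C (-M) *
      fromBlocks N 0 0 (1 : Matrix p p 𝕜)) =
        fromBlocks (-(Nᴴ * F * N)) (-(Nᴴ * Cᴴ)) (-(Nᴴ * Cᴴ))ᴴ M := by
    simp [fromBlocks_conjTranspose, fromBlocks_multiply, fromBlocks_neg]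
  have hdiss : dissipationMatrix G.toStateSpace P L M⁻¹ = -F - Cᴴ * M⁻¹ * C := by
    simp only [dissipationMatrix, Plant.toStateSpace, StateSpace.toMatrix, hF, hC,
      fromBlocks_conjTranspose, fromBlocks_multiply, fromBlocks_neg,
      conjTranspose_fromCols_eq_fromRows_conjTranspose, fromRows_mul,
      Matrix.mul_zero, add_zero, zero_add]
    ext (i | i) (j | j) <;> simp <;> ring
  have hherm : (dissipationMatrix G.toStateSpace P L M⁻¹).IsHermitian :=
    (hP.fromBlocks conjTranspose_zero hL).sub
      (isHermitian_conjTranspose_mul_mul _ (hP.fromBlocks conjTranspose_zero hM.isHermitian.inv))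
  have hschur : -(Nᴴ * F * N) - -(Nᴴ * Cᴴ) * M⁻¹ * (-(Nᴴ * Cᴴ))ᴴ =
      Nᴴ * (-F - Cᴴ * M⁻¹ * C) * N := by
    simp [Matrix.mul_sub, Matrix.sub_mul, Matrix.mul_assoc]
  rw [hCstar, hlmi, posDef_fromBlocks_iff₂₂ _ _ hM, hschur, ← hdiss, hN.posDef_iff hherm]

theorem pqFeasible_iff {cc co : Type*} [Fintype n] [DecidableEq n] [Fintype m] [DecidableEq m]
    [Fintype p] [DecidableEq p] [Fintype cc] [DecidableEq cc] [Fintype co] [DecidableEq co]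
    {G : Plant 𝕜 n m r p q} {Nc : Matrix (n ⊕ p) cc 𝕜}
    {No : Matrix (n ⊕ m) co 𝕜} (hNc : IsOrthonormalKernelBasis (fromCols G.B₂ᴴ G.D₁₂ᴴ) Nc)
    (hNo : IsOrthonormalKernelBasis (fromCols G.C₂ G.D₂₁) No) {P Q : Matrix n n 𝕜}
    {Y : Matrix m m 𝕜} {lam t : ℝ} :
    PQFeasible G Nc No P Q Y lam t ↔ SparsityConstraints Y lam t ∧
      (fromBlocks P 1 1 Q).PosDef ∧ (lam • 1 + Y).PosDef ∧
      PosDefOnKer (dissipationMatrix G.dual.toStateSpace Q 1 (lam • 1 + Y)⁻¹)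
        (fromCols G.dual.C₂ G.dual.D₂₁) ∧
      PosDefOnKer (dissipationMatrix G.toStateSpace P (lam • 1 + Y) 1)
        (fromCols G.C₂ G.D₂₁) := by
  have hlmi (hY : SparsityConstraints Y lam t) (hPQ : (fromBlocks P 1 1 Q).PosDef)
      (hL : (lam • 1 + Y).PosDef) :=
    let hblocks := isHermitian_fromBlocks_iff.1 hPQ.isHermitian
    And.intro
      (IsOrthonormalKernelBasis.posDef_lmi_iff G.dual hNc hblocks.2.2.2 isHermitian_one hL)
      (IsOrthonormalKernelBasis.posDef_lmi_iff G hNo hblocks.1 hL.isHermitian PosDef.one)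
  simp only [Plant.dual, conjTranspose_conjTranspose, neg_add', ← sub_sub, inv_one] at hlmi ⊢
  refine ⟨fun h => ?_, fun ⟨hY, hPQ, hL, hc, ho⟩ =>
    ⟨hY, hPQ, (hlmi hY hPQ hL).1.2 hc, (hlmi hY hPQ hL).2.2 ho⟩⟩
  have hL : (lam • 1 + Y).PosDef := by
    convert h.control_lmi.submatrix Sum.inr_injective using 1
    ext i j
    simp [fromBlocks_conjTranspose, fromBlocks_multiply, add_comm]
  obtain ⟨hc, ho⟩ := hlmi h.sparsity h.coupling hL
  exact ⟨h.sparsity, h.coupling, hL, hc.1 h.control_lmi, ho.1 h.observe_lmi⟩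

end Elimination

section Complexification

open Matrix

variable {𝕜 : Type*} [RCLike 𝕜] {ι κ μ : Type*}

/-- The embedding of `ℝ` or `ℂ` into `ℂ` underlying `toComplexMatrix`. -/
def complexEmbedding (𝕜 : Type*) [RCLike 𝕜] : 𝕜 →+* ℂ where
  __ := RCLike.map 𝕜 ℂ
  map_one' := Complex.ext (by simp) (by simp)
  map_mul' x y := Complex.ext (by simp) (by simp)
  map_zero' := map_zero (RCLike.map 𝕜 ℂ)

theorem norm_toComplexMatrix_apply (M : Matrix ι κ 𝕜) (i : ι) (j : κ) :
    ‖toComplexMatrix M i j‖ = ‖M i j‖ := by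
  simp [toComplexMatrix]

theorem toComplexMatrix_mul [Fintype κ] (M : Matrix ι κ 𝕜) (N : Matrix κ μ 𝕜) :
    toComplexMatrix (M * N) = toComplexMatrix M * toComplexMatrix N :=
  Matrix.map_mul (f := complexEmbedding 𝕜)

theorem toComplexMatrix_sub (M N : Matrix ι κ 𝕜) :
    toComplexMatrix (M - N) = toComplexMatrix M - toComplexMatrix N :=
  Matrix.map_sub _ (map_sub _) M N

theorem toComplexMatrix_pow [Fintype ι] [DecidableEq ι] (M : Matrix ι ι 𝕜) (k : ℕ) :
    toComplexMatrix (M ^ k) = toComplexMatrix M ^ k :=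
  map_pow (complexEmbedding 𝕜).mapMatrix M k

theorem toComplexMatrix_conjTranspose (M : Matrix ι κ 𝕜) :
    toComplexMatrix Mᴴ = (toComplexMatrix M)ᴴ :=
  conjTranspose_map _ fun x => Complex.ext (by simp) (by simp)

theorem toComplexMatrix_fromBlocks_zero_zero (M : Matrix ι ι 𝕜) (N : Matrix κ κ 𝕜) :
    toComplexMatrix (fromBlocks M 0 0 N) =
      fromBlocks (toComplexMatrix M) 0 0 (toComplexMatrix N) := by
  simp [toComplexMatrix, fromBlocks_map]

theorem re_trace_toComplexMatrix [Fintype ι] (M : Matrix ι ι 𝕜) :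
    (toComplexMatrix M).trace.re = RCLike.re M.trace := by
  simp [toComplexMatrix, trace]

theorem posSemidef_toComplexMatrix [Finite ι] {M : Matrix ι ι 𝕜} (hM : M.PosSemidef) :
    (toComplexMatrix M).PosSemidef := by
  have := Fintype.ofFinite ι
  obtain ⟨L, rfl⟩ := exists_eq_conjTranspose_mul_self_of_posSemidef hM le_rfl
  rw [toComplexMatrix_mul, toComplexMatrix_conjTranspose]
  exact posSemidef_conjTranspose_mul_self _

theorem posDef_toComplexMatrix [Finite ι] {M : Matrix ι ι 𝕜} (hM : M.PosDef) :
    (toComplexMatrix M).PosDef := by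
  classical
  have := Fintype.ofFinite ι
  refine (posSemidef_toComplexMatrix hM.posSemidef).posDef_iff_isUnit.2 ?_
  exact hM.isUnit.map (complexEmbedding 𝕜).mapMatrix

end Complexification

section Stability

open Matrix Filter Topology

theorem tendsto_pow_of_spectralRadius_lt_one {A : Type*} [NormedRing A] [NormedAlgebra ℂ A]
    [CompleteSpace A] {a : A} (ha : spectralRadius ℂ a < 1) :
    Tendsto (a ^ ·) atTop (𝓝 0) := by
  obtain ⟨r, har, hr⟩ := ENNReal.lt_iff_exists_nnreal_btwn.1 ha
  refine squeeze_zero_norm' ?_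
    (tendsto_pow_atTop_nhds_zero_of_lt_one r.2 (by exact_mod_cast hr : (r : ℝ) < 1))
  filter_upwards [(spectrum.gelfand_formula a).eventually (gt_mem_nhds har),
    eventually_gt_atTop 0] with k hk hk0
  rw [one_div, ENNReal.rpow_inv_lt_iff (by exact_mod_cast hk0), ENNReal.rpow_natCast] at hk
  exact_mod_cast hk.le

variable {𝕜 : Type*} [RCLike 𝕜] {ι : Type*} [Fintype ι] [DecidableEq ι]

theorem norm_lt_one_of_mem_spectrum {A P : Matrix ι ι ℂ} (hP : P.PosDef)
    (hAP : (P - Aᴴ * P * A).PosDef) {z : ℂ} (hz : z ∈ spectrum ℂ A) : ‖z‖ < 1 := by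
  rw [← spectrum_toLin', ← Module.End.hasEigenvalue_iff_mem_spectrum] at hz
  obtain ⟨v, hv, hv0⟩ := hz.exists_hasEigenvector
  have hAv : A *ᵥ v = z • v := by simpa using Module.End.mem_eigenspace_iff.1 hv
  have hscale : reInner (z • v) (P *ᵥ (z • v)) = ‖z‖ ^ 2 * reInner v (P *ᵥ v) := by
    rw [reInner_apply, reInner_apply, mulVec_smul, star_smul, smul_dotProduct, dotProduct_smul,
      smul_smul, smul_eq_mul, ← starRingEnd_apply, RCLike.conj_mul]
    simp [← Complex.ofReal_pow]
  have hdecay := (posDef_iff_reInner_pos.1 hAP).2 v hv0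
  rw [sub_mulVec, map_sub, reInner_conj_mulVec, hAv, hscale] at hdecay
  have hpos := (posDef_iff_reInner_pos.1 hP).2 v hv0
  have hsq : ‖z‖ ^ 2 < 1 := by nlinarith
  rwa [sq_lt_one_iff₀ (norm_nonneg z)] at hsq

open scoped Matrix.Norms.Operator in
theorem isSchurStable_of_posDef {A P : Matrix ι ι 𝕜} (hP : P.PosDef)
    (hAP : (P - Aᴴ * P * A).PosDef) : IsSchurStable A := by
  rw [IsSchurStable]
  cases isEmpty_or_nonempty ι
  · rw [spectrum.SpectralRadius.of_subsingleton]
    exact zero_lt_one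
  · refine spectrum.spectralRadius_lt_of_forall_lt _ fun z hz => ?_
    refine norm_lt_one_of_mem_spectrum (posDef_toComplexMatrix hP) ?_ hz
    rw [← toComplexMatrix_conjTranspose, ← toComplexMatrix_mul, ← toComplexMatrix_mul,
      ← toComplexMatrix_sub]
    exact posDef_toComplexMatrix hAP

open scoped Matrix.Norms.Operator in
theorem IsSchurStable.tendsto_pow {A : Matrix ι ι 𝕜} (hA : IsSchurStable A) :
    Tendsto (A ^ ·) atTop (𝓝 0) := by
  have hlim := tendsto_pow_of_spectralRadius_lt_one hA
  refine tendsto_pi_nhds.2 fun i => tendsto_pi_nhds.2 fun j => ?_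
  have hij := ((continuous_id.matrix_elem i j).tendsto (0 : Matrix ι ι ℂ)).comp hlim
  refine tendsto_zero_iff_norm_tendsto_zero.2 ((tendsto_zero_iff_norm_tendsto_zero.1 hij).congr
    fun k => ?_)
  rw [Function.comp_apply, ← toComplexMatrix_pow]
  exact norm_toComplexMatrix_apply _ i j

theorem IsSchurStable.posDef_of_posDef {A P : Matrix ι ι 𝕜} (hA : IsSchurStable A)
    (hP : P.IsHermitian) (hAP : (P - Aᴴ * P * A).PosDef) : P.PosDef := by
  have hdecay : ∀ x ≠ 0, reInner (A *ᵥ x) (P *ᵥ (A *ᵥ x)) < reInner x (P *ᵥ x) := fun x hx => by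
    have := (posDef_iff_reInner_pos.1 hAP).2 x hx
    rwa [sub_mulVec, map_sub, reInner_conj_mulVec, sub_pos] at this
  have hpow : ∀ x (k : ℕ), reInner (A ^ k *ᵥ x) (P *ᵥ (A ^ k *ᵥ x)) ≤ reInner x (P *ᵥ x) := by
    intro x k
    induction k with
    | zero => simp
    | succ k ih =>
      rw [pow_succ', ← mulVec_mulVec]
      by_cases h : A ^ k *ᵥ x = 0
      · simpa [h] using ih
      · exact (hdecay _ h).le.trans ih
  have hnonneg : ∀ x, 0 ≤ reInner x (P *ᵥ x) := fun x => by
    have hcont : Continuous fun M : Matrix ι ι 𝕜 => reInner (M *ᵥ x) (P *ᵥ (M *ᵥ x)) := by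
      simp only [reInner_apply]
      fun_prop
    have hlim := (hcont.tendsto 0).comp hA.tendsto_pow
    simp only [zero_mulVec, mulVec_zero, map_zero] at hlim
    exact le_of_tendsto hlim (Eventually.of_forall (hpow x))
  exact posDef_iff_reInner_pos.2 ⟨hP, fun x hx => (hnonneg _).trans_lt (hdecay x hx)⟩

theorem IsSchurStable.eq_zero_of_eq_mul_mul {A X : Matrix ι ι 𝕜} (hA : IsSchurStable A)
    (hX : X = A * X * Aᴴ) : X = 0 := by
  have hpow : ∀ k : ℕ, A ^ k * X * (A ^ k)ᴴ = X := by
    intro k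
    induction k with
    | zero => simp
    | succ k ih =>
      calc A ^ (k + 1) * X * (A ^ (k + 1))ᴴ = A ^ k * (A * X * Aᴴ) * (A ^ k)ᴴ := by
            rw [pow_succ, conjTranspose_mul]
            simp only [Matrix.mul_assoc]
        _ = X := by rw [← hX, ih]
  have hcont : Continuous fun M : Matrix ι ι 𝕜 => M * X * Mᴴ := by fun_prop
  have hlim := (hcont.tendsto 0).comp hA.tendsto_pow
  simp only [Matrix.zero_mul, Function.comp_def, hpow] at hlim
  exact tendsto_nhds_unique tendsto_const_nhds hlim

end Stability

section Moments

open Matrix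

variable {𝕜 : Type*} [RCLike 𝕜] {n m p : Type*}

theorem fromBlocks_conjTranspose_of_isHermitian {V : Matrix (n ⊕ m) (n ⊕ m) 𝕜}
    (hV : V.IsHermitian) :
    fromBlocks V.toBlocks₁₁ V.toBlocks₁₂ V.toBlocks₁₂ᴴ V.toBlocks₂₂ = V := by
  have h : V.toBlocks₁₂ᴴ = V.toBlocks₂₁ := by
    ext i j
    exact hV.apply _ _
  rw [h, fromBlocks_toBlocks]

theorem toMatrix_toComplex (S : StateSpace 𝕜 n m p) :
    S.toComplex.toMatrix = toComplexMatrix S.toMatrix :=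
  (fromBlocks_map S.A S.B S.C S.D _).symm

variable [Fintype n] [Fintype m]

/-- The second-moment matrix of `(x⁺, z)` when `(x, w)` has the second-moment matrix `V`. -/
def StateSpace.outputMoment (S : StateSpace 𝕜 n m p) (V : Matrix (n ⊕ m) (n ⊕ m) 𝕜) :
    Matrix (n ⊕ p) (n ⊕ p) 𝕜 :=
  S.toMatrix * V * S.toMatrixᴴ

theorem trace_mul_dissipationMatrix [Fintype p] [DecidableEq p] (S : StateSpace 𝕜 n m p)
    (V : Matrix (n ⊕ m) (n ⊕ m) 𝕜) (P : Matrix n n 𝕜) (L : Matrix m m 𝕜) :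
    (V * dissipationMatrix S P L 1).trace =
      ((V.toBlocks₁₁ - (S.outputMoment V).toBlocks₁₁) * P).trace + (V.toBlocks₂₂ * L).trace -
        (S.outputMoment V).toBlocks₂₂.trace := by
  have hcycle : (V * (S.toMatrixᴴ * fromBlocks P 0 0 (1 : Matrix p p 𝕜) * S.toMatrix)).trace =
      (S.outputMoment V * fromBlocks P 0 0 1).trace := by
    rw [← Matrix.mul_assoc, trace_mul_comm, StateSpace.outputMoment]
    simp only [Matrix.mul_assoc]
  rw [dissipationMatrix, Matrix.mul_sub, trace_sub, hcycle, trace_mul_fromBlocks_zero_zero,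
    trace_mul_fromBlocks_zero_zero, Matrix.mul_one, Matrix.sub_mul, trace_sub]
  ring

/-- The constraints of the semidefinite relaxation, written for the whole matrix `V = [X R; Rᴴ W]`
and over the field of the system; the budgets `1` and `k` are scaled by `c`, where `c = 0` gives
the recession directions. -/
structure IsRelaxationMoment (S : StateSpace 𝕜 n m p) (k : ℕ) (c : ℝ)
    (V : Matrix (n ⊕ m) (n ⊕ m) 𝕜) : Prop where
  posSemidef : V.PosSemidef
  stationary : V.toBlocks₁₁ = (S.outputMoment V).toBlocks₁₁
  trace_le : RCLike.re V.toBlocks₂₂.trace ≤ c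
  sum_norm_le : ∑ i, ∑ j, ‖V.toBlocks₂₂ i j‖ ≤ c * k

theorem toBlocks₁₁_outputMoment (S : StateSpace 𝕜 n m p) (X : Matrix n n 𝕜) (R : Matrix n m 𝕜)
    (W : Matrix m m 𝕜) :
    (S.outputMoment (fromBlocks X R Rᴴ W)).toBlocks₁₁ =
      fromCols S.A S.B * fromBlocks X R Rᴴ W * fromRows S.Aᴴ S.Bᴴ := by
  simp only [StateSpace.outputMoment, StateSpace.toMatrix, fromBlocks_conjTranspose,
    fromBlocks_multiply, toBlocks_fromBlocks₁₁, fromCols_mul_fromBlocks, fromCols_mul_fromRows]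

theorem relaxationObjective_eq_re_trace [Fintype p] (S : StateSpace ℂ n m p) (X : Matrix n n ℂ)
    (R : Matrix n m ℂ) (W : Matrix m m ℂ) :
    relaxationObjective S X R W =
      (S.outputMoment (fromBlocks X R Rᴴ W)).toBlocks₂₂.trace.re := by
  have hweight : fromBlocks (S.Cᴴ * S.C) (S.Cᴴ * S.D) (S.Dᴴ * S.C) (S.Dᴴ * S.D) =
      (fromCols S.C S.D)ᴴ * fromCols S.C S.D := by
    rw [conjTranspose_fromCols_eq_fromRows_conjTranspose, fromRows_mul_fromCols]
  have houtput : (S.outputMoment (fromBlocks X R Rᴴ W)).toBlocks₂₂ =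
      fromCols S.C S.D * fromBlocks X R Rᴴ W * (fromCols S.C S.D)ᴴ := by
    simp only [StateSpace.outputMoment, StateSpace.toMatrix, fromBlocks_conjTranspose,
      fromBlocks_multiply, toBlocks_fromBlocks₂₂, fromCols_mul_fromBlocks,
      conjTranspose_fromCols_eq_fromRows_conjTranspose, fromCols_mul_fromRows]
  rw [relaxationObjective, hweight, houtput, Matrix.mul_assoc, trace_mul_comm]

theorem mem_relaxationValues_iff [Fintype p] {S : StateSpace 𝕜 n m p} {k : ℕ} {v : ℝ} :
    v ∈ relaxationValues S k ↔ ∃ V, IsRelaxationMoment S.toComplex k 1 V ∧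
      v = (S.toComplex.outputMoment V).toBlocks₂₂.trace.re := by
  constructor
  · rintro ⟨X, R, W, h, rfl⟩
    refine ⟨fromBlocks X R Rᴴ W, ⟨h.posSemidef, ?_, h.trace_le, ?_⟩,
      relaxationObjective_eq_re_trace _ X R W⟩
    · rw [toBlocks₁₁_outputMoment]
      exact h.stationary
    · rw [one_mul]
      exact h.sum_norm_le
  · rintro ⟨V, h, rfl⟩
    have hV := fromBlocks_conjTranspose_of_isHermitian h.posSemidef.isHermitian
    refine ⟨V.toBlocks₁₁, V.toBlocks₁₂, V.toBlocks₂₂, ⟨?_, h.trace_le, ?_, ?_⟩, ?_⟩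
    · rw [← toBlocks₁₁_outputMoment, hV]
      exact h.stationary
    · exact h.sum_norm_le.trans_eq (one_mul _)
    · rw [hV]
      exact h.posSemidef
    · rw [relaxationObjective_eq_re_trace, hV]

theorem zero_mem_relaxationValues [Fintype p] (S : StateSpace 𝕜 n m p) (k : ℕ) :
    0 ∈ relaxationValues S k := by
  refine mem_relaxationValues_iff.2 ⟨0, ⟨.zero, ?_, ?_, ?_⟩, ?_⟩ <;>
    simp [StateSpace.outputMoment, toBlocks₁₁, toBlocks₂₂, trace]

theorem outputMoment_toComplex (S : StateSpace 𝕜 n m p) (V : Matrix (n ⊕ m) (n ⊕ m) 𝕜) :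
    S.toComplex.outputMoment (toComplexMatrix V) = toComplexMatrix (S.outputMoment V) := by
  simp only [StateSpace.outputMoment, toMatrix_toComplex, toComplexMatrix_mul,
    toComplexMatrix_conjTranspose]

theorem IsRelaxationMoment.toComplex {S : StateSpace 𝕜 n m p} {k : ℕ} {c : ℝ}
    {V : Matrix (n ⊕ m) (n ⊕ m) 𝕜} (h : IsRelaxationMoment S k c V) :
    IsRelaxationMoment S.toComplex k c (toComplexMatrix V) where
  posSemidef := posSemidef_toComplexMatrix h.posSemidef
  stationary := by
    rw [outputMoment_toComplex]
    exact congrArg toComplexMatrix h.stationary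
  trace_le := (re_trace_toComplexMatrix V.toBlocks₂₂).trans_le h.trace_le
  sum_norm_le := by
    refine h.sum_norm_le.trans_eq' (Finset.sum_congr rfl fun i _ => Finset.sum_congr rfl ?_)
    exact fun j _ => (norm_toComplexMatrix_apply V.toBlocks₂₂ i j).symm

theorem IsRelaxationMoment.mem_relaxationValues [Fintype p] {S : StateSpace 𝕜 n m p} {k : ℕ}
    {V : Matrix (n ⊕ m) (n ⊕ m) 𝕜} (h : IsRelaxationMoment S k 1 V) :
    RCLike.re (S.outputMoment V).toBlocks₂₂.trace ∈ relaxationValues S k := by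
  refine mem_relaxationValues_iff.2 ⟨toComplexMatrix V, h.toComplex, ?_⟩
  rw [outputMoment_toComplex]
  exact (re_trace_toComplexMatrix _).symm

theorem IsRelaxationMoment.eq_zero {S : StateSpace 𝕜 n m p} [DecidableEq n]
    (hA : IsSchurStable S.A) {k : ℕ} {V : Matrix (n ⊕ m) (n ⊕ m) 𝕜}
    (hV : IsRelaxationMoment S k 0 V) : V = 0 := by
  classical
  obtain ⟨L, rfl⟩ := exists_eq_conjTranspose_mul_self_of_posSemidef hV.posSemidef le_rfl
  obtain ⟨Lx, Lw, rfl⟩ : ∃ Lx Lw, L = fromCols Lx Lw := ⟨_, _, (fromCols_toCols L).symm⟩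
  have htrace := hV.trace_le
  have hstat := hV.stationary
  rw [conjTranspose_fromCols_eq_fromRows_conjTranspose, fromRows_mul_fromCols] at htrace hstat ⊢
  have hLw : Lw = 0 := conjTranspose_mul_self_eq_zero.1 <|
    eq_zero_of_re_trace_mul_nonpos (posSemidef_conjTranspose_mul_self Lw) .one
      (by rwa [Matrix.mul_one])
  subst hLw
  have hX : Lxᴴ * Lx = S.A * (Lxᴴ * Lx) * S.Aᴴ := by
    simpa [StateSpace.outputMoment, StateSpace.toMatrix, fromBlocks_conjTranspose,
      fromBlocks_multiply] using hstat
  rw [hA.eq_zero_of_eq_mul_mul hX]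
  simp

end Moments

section Duality

open Matrix

variable {𝕜 : Type*} [RCLike 𝕜] {n m p : Type*} [Fintype n]

theorem re_trace_mul_le [Fintype m] {W Y : Matrix m m 𝕜} {t : ℝ} (hY : ∀ i j, ‖Y i j‖ ≤ t) :
    RCLike.re (W * Y).trace ≤ t * ∑ i, ∑ j, ‖W i j‖ := by
  simp only [trace, diag_apply, mul_apply, map_sum, Finset.mul_sum]
  refine Finset.sum_le_sum fun i _ => Finset.sum_le_sum fun j _ => ?_
  calc RCLike.re (W i j * Y j i) ≤ ‖W i j * Y j i‖ := RCLike.re_le_norm _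
    _ = ‖Y j i‖ * ‖W i j‖ := by rw [norm_mul, mul_comm]
    _ ≤ t * ‖W i j‖ := mul_le_mul_of_nonneg_right (hY j i) (norm_nonneg _)

theorem re_trace_mul_smul_one_add [Fintype m] [DecidableEq m] (W Y : Matrix m m 𝕜) (lam : ℝ) :
    RCLike.re (W * (lam • (1 : Matrix m m 𝕜) + Y)).trace =
      lam * RCLike.re W.trace + RCLike.re (W * Y).trace := by
  rw [Matrix.mul_add, trace_add, map_add, Matrix.mul_smul, Matrix.mul_one, trace_smul,
    RCLike.smul_re]

theorem SparsityConstraints.toComplex {Y : Matrix m m 𝕜} {lam t : ℝ}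
    (h : SparsityConstraints Y lam t) : SparsityConstraints (toComplexMatrix Y) lam t where
  abs_le i j := (norm_toComplexMatrix_apply Y i j).trans_le (h.abs_le i j)
  isHermitian := by rw [IsHermitian, ← toComplexMatrix_conjTranspose, h.isHermitian.eq]
  t_nonneg := h.t_nonneg
  lam_nonneg := h.lam_nonneg

theorem toComplexMatrix_smul_one_add [DecidableEq m] (lam : ℝ) (Y : Matrix m m 𝕜) :
    toComplexMatrix (lam • (1 : Matrix m m 𝕜) + Y) =
      lam • (1 : Matrix m m ℂ) + toComplexMatrix Y := by
  ext i j
  by_cases h : i = j <;> simp [toComplexMatrix, h, RCLike.smul_re, RCLike.smul_im, add_assoc]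

theorem toComplexMatrix_dissipationMatrix [Fintype p] [DecidableEq p] (S : StateSpace 𝕜 n m p)
    (P : Matrix n n 𝕜) (L : Matrix m m 𝕜) :
    toComplexMatrix (dissipationMatrix S P L 1) =
      dissipationMatrix S.toComplex (toComplexMatrix P) (toComplexMatrix L) 1 := by
  have hone : toComplexMatrix (1 : Matrix p p 𝕜) = 1 := map_one (complexEmbedding 𝕜).mapMatrix
  rw [dissipationMatrix, dissipationMatrix, toMatrix_toComplex, toComplexMatrix_sub,
    toComplexMatrix_mul, toComplexMatrix_mul, toComplexMatrix_conjTranspose,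
    toComplexMatrix_fromBlocks_zero_zero, toComplexMatrix_fromBlocks_zero_zero, hone]

theorem le_of_mem_relaxationValues [Fintype m] [Fintype p] [DecidableEq m] [DecidableEq p]
    {S : StateSpace 𝕜 n m p} {k : ℕ} {P : Matrix n n 𝕜} {Y : Matrix m m 𝕜} {lam t : ℝ}
    (hY : SparsityConstraints Y lam t)
    (hS : (dissipationMatrix S P (lam • (1 : Matrix m m 𝕜) + Y) 1).PosDef) {v : ℝ}
    (hv : v ∈ relaxationValues S k) : v ≤ lam + k * t := by
  obtain ⟨V, hV, rfl⟩ := mem_relaxationValues_iff.1 hv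
  have hS' := posDef_toComplexMatrix hS
  rw [toComplexMatrix_dissipationMatrix, toComplexMatrix_smul_one_add] at hS'
  have hlag := re_trace_mul_nonneg hV.posSemidef hS'.posSemidef
  rw [trace_mul_dissipationMatrix, ← hV.stationary, sub_self, Matrix.zero_mul, trace_zero,
    zero_add, map_sub, re_trace_mul_smul_one_add] at hlag
  have hnoise := re_trace_mul_le (W := V.toBlocks₂₂) hY.toComplex.abs_le
  have hbudget := mul_le_mul_of_nonneg_left hV.sum_norm_le hY.t_nonneg
  have htrace := mul_le_mul_of_nonneg_left hV.trace_le hY.lam_nonneg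
  simp only [RCLike.re_to_complex] at hlag hnoise htrace
  linarith

theorem SparsityConstraints.convex_combination {Y Y' : Matrix m m 𝕜} {lam lam' t t' : ℝ}
    (h : SparsityConstraints Y lam t) (h' : SparsityConstraints Y' lam' t') {a b : ℝ}
    (ha : 0 ≤ a) (hb : 0 ≤ b) :
    SparsityConstraints (a • Y + b • Y') (a * lam + b * lam') (a * t + b * t') where
  abs_le i j := by
    refine (norm_add_le _ _).trans ?_
    rw [Matrix.smul_apply, Matrix.smul_apply, norm_smul, norm_smul, Real.norm_of_nonneg ha,
      Real.norm_of_nonneg hb]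
    exact add_le_add (mul_le_mul_of_nonneg_left (h.abs_le i j) ha)
      (mul_le_mul_of_nonneg_left (h'.abs_le i j) hb)
  isHermitian := (h.isHermitian.smul (.all a)).add (h'.isHermitian.smul (.all b))
  t_nonneg := add_nonneg (mul_nonneg ha h.t_nonneg) (mul_nonneg hb h'.t_nonneg)
  lam_nonneg := add_nonneg (mul_nonneg ha h.lam_nonneg) (mul_nonneg hb h'.lam_nonneg)

theorem sparsityConstraints_zero {lam : ℝ} (h : 0 ≤ lam) :
    SparsityConstraints (0 : Matrix m m 𝕜) lam 0 :=
  ⟨fun i j => by simp, isHermitian_zero, le_rfl, h⟩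

/-- The entrywise phases of `W`: the extremal matrix in the duality between the entrywise `ℓ¹`
and `ℓ^∞` norms. Where an entry vanishes, `0⁻¹ = 0` makes its phase `0`. -/
def phaseMatrix (W : Matrix m m 𝕜) : Matrix m m 𝕜 :=
  of fun i j => ((‖W i j‖⁻¹ : ℝ) : 𝕜) * W i j

theorem re_trace_mul_phaseMatrix [Fintype m] {W : Matrix m m 𝕜} (hW : W.IsHermitian) :
    RCLike.re (W * phaseMatrix W).trace = ∑ i, ∑ j, ‖W i j‖ := by
  simp only [trace, diag_apply, mul_apply, map_sum]
  refine Finset.sum_congr rfl fun i _ => Finset.sum_congr rfl fun j _ => ?_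
  rw [phaseMatrix, of_apply, ← hW.apply j i, norm_star, mul_left_comm, ← starRingEnd_apply,
    RCLike.mul_conj, ← RCLike.ofReal_pow, ← RCLike.ofReal_mul, RCLike.ofReal_re, sq, ← mul_assoc]
  by_cases h : ‖W i j‖ = 0
  · simp [h]
  · rw [inv_mul_cancel₀ h, one_mul]

theorem sparsityConstraints_phaseMatrix {W : Matrix m m 𝕜} (hW : W.IsHermitian) {s : ℝ}
    (hs : 0 ≤ s) : SparsityConstraints (s • phaseMatrix W) 0 s where
  abs_le i j := by
    rw [Matrix.smul_apply, norm_smul, Real.norm_of_nonneg hs, phaseMatrix, of_apply, norm_mul,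
      RCLike.norm_ofReal, abs_inv, abs_norm]
    exact mul_le_of_le_one_right hs inv_mul_le_one
  isHermitian := by
    refine IsHermitian.smul (.ext fun i j => ?_) (.all s)
    rw [phaseMatrix, of_apply, of_apply, star_mul', hW.apply, ← hW.apply i j, norm_star,
      ← starRingEnd_apply, RCLike.conj_ofReal]
  t_nonneg := hs
  lam_nonneg := le_rfl

variable [Fintype p] [DecidableEq p]

theorem dissipationMatrix_convex_combination (S : StateSpace 𝕜 n m p) (P P' : Matrix n n 𝕜)
    (L L' : Matrix m m 𝕜) {a b : ℝ} (hab : a + b = 1) :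
    dissipationMatrix S (a • P + b • P') (a • L + b • L') 1 =
      a • dissipationMatrix S P L 1 + b • dissipationMatrix S P' L' 1 := by
  have hstorage : fromBlocks (a • P + b • P') 0 0 (1 : Matrix p p 𝕜) =
      a • fromBlocks P 0 0 1 + b • fromBlocks P' 0 0 1 := by
    simp [fromBlocks_smul, fromBlocks_add, ← add_smul, hab]
  have hsupply : fromBlocks (a • P + b • P') 0 0 (a • L + b • L') =
      a • fromBlocks P 0 0 L + b • fromBlocks P' 0 0 L' := by
    simp [fromBlocks_smul, fromBlocks_add]
  rw [dissipationMatrix, hstorage, hsupply, dissipationMatrix, dissipationMatrix]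
  simp only [Matrix.mul_add, Matrix.add_mul, Matrix.mul_smul, Matrix.smul_mul, smul_sub]
  abel

theorem isHermitian_dissipationMatrix (S : StateSpace 𝕜 n m p) {P : Matrix n n 𝕜}
    {L : Matrix m m 𝕜} (hP : P.IsHermitian) (hL : L.IsHermitian) :
    (dissipationMatrix S P L 1).IsHermitian :=
  (hP.fromBlocks (by simp) hL).sub
    (isHermitian_conjTranspose_mul_mul _ (hP.fromBlocks (by simp) isHermitian_one))

variable [DecidableEq m]

/-- The dissipation matrices of the dual points `(P, Y, λ, t)`, paired with the amount by which
the dual objective `λ + k t` stays below `β`. -/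
def dualPoints (S : StateSpace 𝕜 n m p) (k : ℕ) (β : ℝ) :
    Set (Matrix (n ⊕ m) (n ⊕ m) 𝕜 × ℝ) :=
  {x | ∃ P Y, ∃ lam t : ℝ, P.IsHermitian ∧ SparsityConstraints Y lam t ∧
    x = (dissipationMatrix S P (lam • (1 : Matrix m m 𝕜) + Y) 1, β - (lam + k * t))}

theorem convex_dualPoints (S : StateSpace 𝕜 n m p) (k : ℕ) (β : ℝ) :
    Convex ℝ (dualPoints S k β) := by
  rintro _ ⟨P, Y, lam, t, hP, hY, rfl⟩ _ ⟨P', Y', lam', t', hP', hY', rfl⟩ a b ha hb hab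
  refine ⟨a • P + b • P', a • Y + b • Y', a * lam + b * lam', a * t + b * t',
    (hP.smul (.all a)).add (hP'.smul (.all b)), hY.convex_combination hY' ha hb,
    Prod.ext ?_ ?_⟩
  · have hL : (a * lam + b * lam') • (1 : Matrix m m 𝕜) + (a • Y + b • Y') =
        a • (lam • (1 : Matrix m m 𝕜) + Y) + b • (lam' • (1 : Matrix m m 𝕜) + Y') := by
      simp only [smul_add, add_smul, mul_smul]
      abel
    rw [hL, dissipationMatrix_convex_combination S P P' _ _ hab]
    rfl
  · change a * (β - (lam + k * t)) + b * (β - (lam' + k * t')) = _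
    linear_combination β * hab

theorem isHermitian_of_mem_dualPoints {S : StateSpace 𝕜 n m p} {k : ℕ} {β : ℝ}
    {x : Matrix (n ⊕ m) (n ⊕ m) 𝕜 × ℝ} (hx : x ∈ dualPoints S k β) : x.1.IsHermitian := by
  obtain ⟨P, Y, lam, t, hP, hY, rfl⟩ := hx
  exact isHermitian_dissipationMatrix S hP hY.isHermitian_smul_one_add

theorem isRelaxationMoment_of_forall_dualPoints [Fintype m] {S : StateSpace 𝕜 n m p} {k : ℕ}
    {β c : ℝ} {V : Matrix (n ⊕ m) (n ⊕ m) 𝕜} (hV : V.PosSemidef)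
    (h : ∀ x ∈ dualPoints S k β, RCLike.re (V * x.1).trace + c * x.2 ≤ 0) :
    IsRelaxationMoment S k c V ∧ c * β ≤ RCLike.re (S.outputMoment V).toBlocks₂₂.trace := by
  set obj := RCLike.re (S.outputMoment V).toBlocks₂₂.trace
  set N := V.toBlocks₁₁ - (S.outputMoment V).toBlocks₁₁ with hN
  have hW : V.toBlocks₂₂.IsHermitian := hV.isHermitian.submatrix Sum.inr
  have hNherm : N.IsHermitian := (hV.isHermitian.submatrix Sum.inl).sub
    ((isHermitian_mul_mul_conjTranspose _ hV.isHermitian).submatrix Sum.inl)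
  have hlag : ∀ {P Y lam t}, P.IsHermitian → SparsityConstraints Y lam t →
      RCLike.re (N * P).trace + lam * (RCLike.re V.toBlocks₂₂.trace - c) +
        (RCLike.re (V.toBlocks₂₂ * Y).trace - t * (c * k)) ≤ obj - c * β := by
    intro P Y lam t hP hY
    have := h _ ⟨P, Y, lam, t, hP, hY, rfl⟩
    rw [trace_mul_dissipationMatrix, map_sub, map_add, re_trace_mul_smul_one_add] at this
    linarith
  have hnonpos : ∀ {a : ℝ}, (∀ s : ℝ, 0 < s → s * a ≤ obj - c * β) → a ≤ 0 := fun ha =>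
    (nonpos_and_nonneg_of_forall_pos_mul_lt fun s hs => (ha s hs).trans_lt (lt_add_one _)).1
  refine ⟨⟨hV, sub_eq_zero.1 ?_, sub_nonpos.1 (hnonpos fun s hs => ?_),
    sub_nonpos.1 (hnonpos fun s hs => ?_)⟩, ?_⟩
  · refine eq_zero_of_forall_mul_re_trace_le (c := obj - c * β) fun s => ?_
    simpa [← hN, hNherm.eq, RCLike.smul_re] using
      hlag (hNherm.smul (.all s)) (sparsityConstraints_zero le_rfl)
  · simpa using hlag isHermitian_zero (sparsityConstraints_zero hs.le)
  · simpa [re_trace_mul_phaseMatrix hW, RCLike.smul_re, mul_sub] using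
      hlag isHermitian_zero (sparsityConstraints_phaseMatrix hW hs.le)
  · simpa using hlag isHermitian_zero (sparsityConstraints_zero le_rfl)

variable [DecidableEq n]

theorem IsSchurStable.exists_posDef_mem_dualPoints [Finite m] {S : StateSpace 𝕜 n m p}
    (hA : IsSchurStable S.A) (k : ℕ) (β : ℝ) : ∃ x ∈ dualPoints S k β, x.1.PosDef := by
  have := Fintype.ofFinite m
  by_contra! hno
  obtain ⟨Z, hZ, hZ0, hle⟩ := exists_posSemidef_of_forall_not_posDef
    (S := Prod.fst '' dualPoints S k β)
    (Set.Nonempty.image _ ⟨_, 0, 0, 0, 0, isHermitian_zero, sparsityConstraints_zero le_rfl, rfl⟩)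
    ((convex_dualPoints S k β).linear_image (LinearMap.fst ℝ _ _))
    (Set.forall_mem_image.2 fun _ => isHermitian_of_mem_dualPoints) (Set.forall_mem_image.2 hno)
  have hZfeas := isRelaxationMoment_of_forall_dualPoints hZ (c := 0) fun x hx => by
    simpa using hle _ (Set.mem_image_of_mem _ hx)
  exact hZ0 (hZfeas.1.eq_zero hA)

theorem IsSchurStable.exists_posDef_dissipationMatrix_of_lt [Fintype m] {S : StateSpace 𝕜 n m p}
    (hA : IsSchurStable S.A) {k : ℕ} {β : ℝ} (hβ : ∀ v ∈ relaxationValues S k, v < β) :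
    ∃ (P : Matrix n n 𝕜) (Y : Matrix m m 𝕜) (lam t : ℝ), P.IsHermitian ∧
      SparsityConstraints Y lam t ∧
      (dissipationMatrix S P (lam • (1 : Matrix m m 𝕜) + Y) 1).PosDef ∧ lam + k * t < β := by
  suffices hgap : ∃ x ∈ dualPoints S k β, x.1.PosDef ∧ 0 < x.2 by
    obtain ⟨_, ⟨P, Y, lam, t, hP, hY, rfl⟩, hpos, hgap⟩ := hgap
    exact ⟨P, Y, lam, t, hP, hY, hpos, sub_pos.1 hgap⟩
  by_contra! hopt
  obtain ⟨Z, hZ, hle⟩ := exists_posSemidef_multiplier (convex_dualPoints S k β)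
    (fun _ => isHermitian_of_mem_dualPoints) (hA.exists_posDef_mem_dualPoints k β) hopt
  obtain ⟨hZfeas, hval⟩ := isRelaxationMoment_of_forall_dualPoints hZ (c := 1) (by simpa using hle)
  exact (hβ _ hZfeas.mem_relaxationValues).not_ge (by simpa using hval)

end Duality

section RelaxedNorm

open Matrix

variable {𝕜 : Type*} [RCLike 𝕜] {n m p : Type*} [Fintype n] [Fintype m] [Fintype p]

theorem IsSchurStable.isLUB_relaxedNorm_sq [DecidableEq n] {S : StateSpace 𝕜 n m p}
    (hA : IsSchurStable S.A) (k : ℕ) : IsLUB (relaxationValues S k) (relaxedNorm S k ^ 2) := by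
  classical
  obtain ⟨_, ⟨P, Y, lam, t, -, hY, rfl⟩, hpos⟩ := hA.exists_posDef_mem_dualPoints k 0
  have hbdd : BddAbove (relaxationValues S k) :=
    ⟨lam + k * t, fun _ hv => le_of_mem_relaxationValues hY hpos hv⟩
  rw [relaxedNorm, Real.sq_sqrt (le_csSup hbdd (zero_mem_relaxationValues S k))]
  exact isLUB_csSup ⟨0, zero_mem_relaxationValues S k⟩ hbdd

end RelaxedNorm

section Reconstruction

open Matrix Topology

variable {𝕜 : Type*} [RCLike 𝕜] {n ν m r p q cc co : Type*}

theorem toBlocks₁₁_inv_fromBlocks {R ι κ : Type*} [CommRing R] [Fintype ι] [DecidableEq ι]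
    [Fintype κ] [DecidableEq κ] {A : Matrix ι ι R} {B : Matrix ι κ R} {C : Matrix κ ι R}
    {D : Matrix κ κ R} (hD : IsUnit D) (h : IsUnit (fromBlocks A B C D)) :
    (fromBlocks A B C D)⁻¹.toBlocks₁₁ = (A - B * D⁻¹ * C)⁻¹ := by
  let := hD.invertible
  let := h.invertible
  let := (isUnit_fromBlocks_iff_of_invertible₂₂.1 h).invertible
  rw [← invOf_eq_nonsing_inv (fromBlocks A B C D), invOf_fromBlocks₂₂_eq, toBlocks_fromBlocks₁₁,
    invOf_eq_nonsing_inv, invOf_eq_nonsing_inv]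

theorem posDef_fromBlocks_one_one_iff [Fintype n] [DecidableEq n] {P Q : Matrix n n 𝕜}
    (hQ : Q.PosDef) : (fromBlocks P 1 1 Q).PosDef ↔ (P - Q⁻¹).PosDef := by
  simpa using posDef_fromBlocks_iff₂₂ P 1 hQ

theorem posSemidef_toBlocks₁₁_sub_inv_toBlocks₁₁_inv {ι κ : Type*} [Fintype ι] [DecidableEq ι]
    [Fintype κ] [DecidableEq κ] {M : Matrix (ι ⊕ κ) (ι ⊕ κ) 𝕜} (hM : M.PosDef) :
    (M.toBlocks₁₁ - (M⁻¹.toBlocks₁₁)⁻¹).PosSemidef := by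
  have hM₂₂ : M.toBlocks₂₂.PosDef := hM.submatrix Sum.inr_injective
  have hblocks := fromBlocks_conjTranspose_of_isHermitian hM.isHermitian
  have hschur : (M.toBlocks₁₁ - M.toBlocks₁₂ * M.toBlocks₂₂⁻¹ * M.toBlocks₁₂ᴴ).PosDef :=
    (posDef_fromBlocks_iff₂₂ _ _ hM₂₂).1 (hblocks ▸ hM)
  have hinv : M⁻¹.toBlocks₁₁ =
      (M.toBlocks₁₁ - M.toBlocks₁₂ * M.toBlocks₂₂⁻¹ * M.toBlocks₁₂ᴴ)⁻¹ := by
    rw [← toBlocks₁₁_inv_fromBlocks hM₂₂.isUnit (hblocks.symm ▸ hM.isUnit), hblocks]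
  rw [hinv, nonsing_inv_inv_of_posDef hschur, sub_sub_cancel]
  exact hM₂₂.inv.posSemidef.mul_mul_conjTranspose_same _

theorem continuous_dissipationMatrix [Fintype n] [Fintype p] (S : StateSpace 𝕜 n m p)
    (L : Matrix m m 𝕜) (M : Matrix p p 𝕜) :
    Continuous fun P => dissipationMatrix S P L M := by
  unfold dissipationMatrix
  fun_prop

theorem exists_pos_posDefOnKer_dissipationMatrix_add_smul_one [Fintype n] [DecidableEq n]
    [Fintype m] [Fintype p] {κ : Type*} {S : StateSpace 𝕜 n m p} {P : Matrix n n 𝕜}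
    {L : Matrix m m 𝕜} {M : Matrix p p 𝕜} {N : Matrix κ (n ⊕ m) 𝕜}
    (h : PosDefOnKer (dissipationMatrix S P L M) N) :
    ∃ ε : ℝ, 0 < ε ∧ PosDefOnKer (dissipationMatrix S (P + ε • 1) L M) N := by
  have hcont : Continuous fun ε : ℝ => dissipationMatrix S (P + ε • 1) L M :=
    (continuous_dissipationMatrix S L M).comp
      (continuous_const.add (continuous_id.smul continuous_const))
  have hmem : ∀ᶠ ε : ℝ in 𝓝 0, PosDefOnKer (dissipationMatrix S (P + ε • 1) L M) N :=
    hcont.continuousAt.eventually ((isOpen_setOf_posDefOnKer N).mem_nhds (by simpa using h))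
  obtain ⟨ε, hpos, hε⟩ :=
    ((hmem.filter_mono nhdsWithin_le_nhds).and (self_mem_nhdsWithin (s := Set.Ioi 0))).exists
  exact ⟨ε, hε, hpos⟩

variable [Fintype n] [DecidableEq n] [Fintype m] [DecidableEq m] [Fintype p] [DecidableEq p]
  [Fintype cc] [Fintype co] {G : Plant 𝕜 n m r p q} {Nc : Matrix (n ⊕ p) cc 𝕜}
  {No : Matrix (n ⊕ m) co 𝕜} {P Q : Matrix n n 𝕜} {Y : Matrix m m 𝕜} {lam t : ℝ}

theorem PQFeasible.posDef_right (h : PQFeasible G Nc No P Q Y lam t) : Q.PosDef :=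
  h.coupling.submatrix Sum.inr_injective

theorem PQFeasible.exists_sub_inv_eq_conjTranspose_mul_self
    [Fintype ν] (h : PQFeasible G Nc No P Q Y lam t)
    (hcard : Fintype.card n ≤ Fintype.card ν) :
    ∃ P₂ : Matrix ν n 𝕜, P - Q⁻¹ = P₂ᴴ * P₂ :=
  exists_eq_conjTranspose_mul_self_of_posSemidef
    ((posDef_fromBlocks_one_one_iff h.posDef_right).1 h.coupling).posSemidef hcard

variable [Fintype ν] [Fintype r] [Fintype q]

theorem SynthesisFeasible.exists_pqFeasible [DecidableEq cc] [DecidableEq co]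
    {K : Controller 𝕜 ν r q}
    {Pcl : Matrix (n ⊕ ν) (n ⊕ ν) 𝕜} (h : SynthesisFeasible G K Pcl Y lam t)
    (hNc : IsOrthonormalKernelBasis (fromCols G.B₂ᴴ G.D₁₂ᴴ) Nc)
    (hNo : IsOrthonormalKernelBasis (fromCols G.C₂ G.D₂₁) No) :
    ∃ P Q, PQFeasible G Nc No P Q Y lam t := by
  classical
  have hPcl := h.Pcl_posDef
  obtain ⟨hY, hcons⟩ := constructionFeasible_iff_posDef.1
    ((constructionFeasible_iff_synthesisFeasible hPcl).2 h)
  have hL : (lam • 1 + Y).PosDef :=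
    hcons.submatrix (Sum.inr_injective.comp Sum.inr_injective)
  obtain ⟨hcontrol, hobserve⟩ := (exists_posDef_constructionMatrix_iff G hPcl hL).1 ⟨K, hcons⟩
  obtain ⟨ε, hε, hobserve'⟩ := exists_pos_posDefOnKer_dissipationMatrix_add_smul_one hobserve
  have hQ : Pcl⁻¹.toBlocks₁₁.PosDef := hPcl.inv.submatrix Sum.inl_injective
  refine ⟨_, _, (pqFeasible_iff hNc hNo).2
    ⟨hY, (posDef_fromBlocks_one_one_iff hQ).2 ?_, hL, hcontrol, hobserve'⟩⟩
  rw [add_sub_right_comm]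
  exact (PosDef.one.smul hε).posSemidef_add (posSemidef_toBlocks₁₁_sub_inv_toBlocks₁₁_inv hPcl)

variable [DecidableEq ν]

theorem posDef_reconstructedPcl (hQ : Q.PosDef) {P₂ : Matrix ν n 𝕜} (hP₂ : P - Q⁻¹ = P₂ᴴ * P₂) :
    (reconstructedPcl P P₂).PosDef := by
  have h := posDef_fromBlocks_iff₂₂ P P₂ᴴ (PosDef.one (n := ν) (R := 𝕜))
  rw [inv_one, Matrix.mul_one, conjTranspose_conjTranspose, ← hP₂, sub_sub_cancel] at h
  exact h.2 hQ.inv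

theorem toBlocks₁₁_inv_reconstructedPcl (hQ : Q.PosDef) {P₂ : Matrix ν n 𝕜}
    (hP₂ : P - Q⁻¹ = P₂ᴴ * P₂) : (reconstructedPcl P P₂)⁻¹.toBlocks₁₁ = Q := by
  rw [reconstructedPcl, toBlocks₁₁_inv_fromBlocks isUnit_one
    (posDef_reconstructedPcl hQ hP₂).isUnit, inv_one, Matrix.mul_one, ← hP₂, sub_sub_cancel,
    nonsing_inv_inv_of_posDef hQ]

theorem PQFeasible.exists_constructionFeasible [DecidableEq cc] [DecidableEq co]
    (h : PQFeasible G Nc No P Q Y lam t)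
    (hNc : IsOrthonormalKernelBasis (fromCols G.B₂ᴴ G.D₁₂ᴴ) Nc)
    (hNo : IsOrthonormalKernelBasis (fromCols G.C₂ G.D₂₁) No) {P₂ : Matrix ν n 𝕜}
    (hP₂ : P - Q⁻¹ = P₂ᴴ * P₂) :
    ∃ K : Controller 𝕜 ν r q, ConstructionFeasible G (reconstructedPcl P P₂) K Y lam t := by
  obtain ⟨hY, -, hL, hcontrol, hobserve⟩ := (pqFeasible_iff hNc hNo).1 h
  have hQ := h.posDef_right
  obtain ⟨K, hK⟩ := (exists_posDef_constructionMatrix_iff G (posDef_reconstructedPcl hQ hP₂) hL).2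
    ⟨(toBlocks₁₁_inv_reconstructedPcl hQ hP₂).symm ▸ hcontrol, hobserve⟩
  exact ⟨K, constructionFeasible_iff_posDef.2 ⟨hY, hK⟩⟩

end Reconstruction

section OptimalValues

open Matrix

variable {𝕜 : Type*} [RCLike 𝕜] {n ν m r p q cc co : Type*} [Fintype n] [Fintype p]

theorem exists_isGLB_of_mem_lowerBounds {α : Type*} [ConditionallyCompleteLattice α] {s : Set α}
    {a b : α} (ha : a ∈ lowerBounds s) (hb : b ∈ s) : ∃ c, IsGLB s c ∧ a ≤ c ∧ c ≤ b :=
  have hglb := isGLB_csInf ⟨b, hb⟩ ⟨a, ha⟩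
  ⟨_, hglb, hglb.2 ha, hglb.1 hb⟩

theorem posDef_sub_of_posDef_dissipationMatrix [DecidableEq p] {S : StateSpace 𝕜 n m p}
    {P : Matrix n n 𝕜} {L : Matrix m m 𝕜} (h : (dissipationMatrix S P L 1).PosDef) :
    (P - S.Aᴴ * P * S.A).PosDef := by
  have hstate : (dissipationMatrix S P L 1).toBlocks₁₁.PosDef :=
    h.submatrix Sum.inl_injective
  convert hstate.add_posSemidef (posSemidef_conjTranspose_mul_self S.C) using 1
  rw [dissipationMatrix_eq_neg_fromBlocks, fromBlocks_add, fromBlocks_neg, toBlocks_fromBlocks₁₁]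
  abel

variable [Fintype ν] [Fintype r] [Fintype q] [DecidableEq m] {G : Plant 𝕜 n m r p q}
  {K : Controller 𝕜 ν r q} {Pcl : Matrix (n ⊕ ν) (n ⊕ ν) 𝕜} {Nc : Matrix (n ⊕ p) cc 𝕜}
  {No : Matrix (n ⊕ m) co 𝕜} {Y : Matrix m m 𝕜} {lam t : ℝ}

theorem SynthesisFeasible.stabilizes [DecidableEq n] [DecidableEq ν]
    (h : SynthesisFeasible G K Pcl Y lam t) : Stabilizes G K := by
  classical
  exact isSchurStable_of_posDef h.Pcl_posDef
    (posDef_sub_of_posDef_dissipationMatrix (synthesisFeasible_iff.1 h).2.2)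

theorem SynthesisFeasible.relaxedNorm_sq_le [Fintype m] (h : SynthesisFeasible G K Pcl Y lam t)
    (k : ℕ) : relaxedNorm (closedLoop G K) k ^ 2 ≤ lam + k * t := by
  classical
  exact (IsSchurStable.isLUB_relaxedNorm_sq h.stabilizes k).2 fun _ hv =>
    le_of_mem_relaxationValues h.sparsity (synthesisFeasible_iff.1 h).2.2 hv

variable [DecidableEq n] [DecidableEq ν]

theorem Stabilizes.exists_synthesisFeasible_of_lt [Fintype m] (hK : Stabilizes G K) {k : ℕ}
    {β : ℝ} (hβ : relaxedNorm (closedLoop G K) k ^ 2 < β) :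
    ∃ Pcl Y lam t, SynthesisFeasible G K Pcl Y lam t ∧ lam + k * t < β := by
  classical
  obtain ⟨P, Y, lam, t, hP, hY, hpos, hlt⟩ :=
    IsSchurStable.exists_posDef_dissipationMatrix_of_lt hK fun v hv =>
      ((IsSchurStable.isLUB_relaxedNorm_sq hK k).1 hv).trans_lt hβ
  exact ⟨P, Y, lam, t, synthesisFeasible_iff.2 ⟨hY, IsSchurStable.posDef_of_posDef hK hP
    (posDef_sub_of_posDef_dissipationMatrix hpos), hpos⟩, hlt⟩

/-- The values `μ̄ₖ(M_K)²` of the squared relaxed norm over the stabilizing controllers with state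
index `ν`. -/
def relaxedNormValues (ν : Type*) [Fintype ν] [DecidableEq ν] [Fintype m]
    (G : Plant 𝕜 n m r p q) (k : ℕ) : Set ℝ :=
  {v | ∃ K : Controller 𝕜 ν r q, Stabilizes G K ∧ v = relaxedNorm (closedLoop G K) k ^ 2}

/-- The values of the objective of the synthesis problem at feasible points with controllers of
state index `ν`. -/
def synthesisValues (ν : Type*) [Fintype ν] (G : Plant 𝕜 n m r p q) (k : ℕ) : Set ℝ :=
  {v | ∃ (K : Controller 𝕜 ν r q) (Pcl : _) (Y : _) (lam t : ℝ),
    SynthesisFeasible G K Pcl Y lam t ∧ v = lam + k * t}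

/-- The values of the objective of the first semidefinite program at feasible points. -/
def pqValues [Fintype m] [DecidableEq p] [Fintype cc] [Fintype co] (G : Plant 𝕜 n m r p q)
    (Nc : Matrix (n ⊕ p) cc 𝕜) (No : Matrix (n ⊕ m) co 𝕜) (k : ℕ) : Set ℝ :=
  {v | ∃ (P Q : _) (Y : _) (lam t : ℝ), PQFeasible G Nc No P Q Y lam t ∧ v = lam + k * t}

/-- The values of the objective of the second semidefinite program at feasible points, for a fixed
matrix `Pcl`. -/
def constructionValues [DecidableEq p] (G : Plant 𝕜 n m r p q)
    (Pcl : Matrix (n ⊕ ν) (n ⊕ ν) 𝕜) (k : ℕ) : Set ℝ :=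
  {v | ∃ (K : Controller 𝕜 ν r q) (Y : _) (lam t : ℝ),
    ConstructionFeasible G Pcl K Y lam t ∧ v = lam + k * t}

theorem lowerBounds_synthesisValues (ν : Type*) [Fintype ν] [DecidableEq ν] [Fintype m]
    (G : Plant 𝕜 n m r p q) (k : ℕ) :
    lowerBounds (synthesisValues ν G k) = lowerBounds (relaxedNormValues ν G k) := by
  ext b
  constructor
  · rintro hb _ ⟨K, hK, rfl⟩
    refine le_of_forall_gt_imp_ge_of_dense fun β hβ => ?_
    obtain ⟨Pcl, Y, lam, t, h, hlt⟩ := hK.exists_synthesisFeasible_of_lt hβ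
    exact (hb ⟨K, Pcl, Y, lam, t, h, rfl⟩).trans hlt.le
  · rintro hb _ ⟨K, Pcl, Y, lam, t, h, rfl⟩
    exact (hb ⟨K, h.stabilizes, rfl⟩).trans (h.relaxedNorm_sq_le k)

theorem constructionValues_subset_synthesisValues [Finite m] [DecidableEq p] (hPcl : Pcl.PosDef)
    (k : ℕ) : constructionValues G Pcl k ⊆ synthesisValues ν G k := by
  rintro _ ⟨K, Y, lam, t, h, rfl⟩
  exact ⟨K, Pcl, Y, lam, t, (constructionFeasible_iff_synthesisFeasible hPcl).1 h, rfl⟩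

variable [Fintype m] [Fintype cc] [DecidableEq cc] [Fintype co] [DecidableEq co]

omit [DecidableEq ν] in
theorem exists_synthesisFeasible_iff_exists_pqFeasible [DecidableEq p]
    (hcard : Fintype.card n ≤ Fintype.card ν)
    (hNc : IsOrthonormalKernelBasis (fromCols G.B₂ᴴ G.D₁₂ᴴ) Nc)
    (hNo : IsOrthonormalKernelBasis (fromCols G.C₂ G.D₂₁) No) :
    (∃ (K : Controller 𝕜 ν r q) (Pcl : _), SynthesisFeasible G K Pcl Y lam t) ↔
      ∃ P Q, PQFeasible G Nc No P Q Y lam t := by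
  classical
  refine ⟨fun ⟨K, Pcl, h⟩ => h.exists_pqFeasible hNc hNo, fun ⟨P, Q, h⟩ => ?_⟩
  obtain ⟨P₂, hP₂⟩ := h.exists_sub_inv_eq_conjTranspose_mul_self hcard
  obtain ⟨K, hK⟩ := h.exists_constructionFeasible hNc hNo hP₂
  exact ⟨K, _, (constructionFeasible_iff_synthesisFeasible
    (posDef_reconstructedPcl h.posDef_right hP₂)).1 hK⟩

omit [DecidableEq ν] in
theorem pqValues_eq_synthesisValues [DecidableEq p] (hcard : Fintype.card n ≤ Fintype.card ν)
    (hNc : IsOrthonormalKernelBasis (fromCols G.B₂ᴴ G.D₁₂ᴴ) Nc)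
    (hNo : IsOrthonormalKernelBasis (fromCols G.C₂ G.D₂₁) No) (k : ℕ) :
    pqValues G Nc No k = synthesisValues ν G k := by
  ext v
  constructor
  · rintro ⟨P, Q, Y, lam, t, h, rfl⟩
    obtain ⟨K, Pcl, hK⟩ :=
      (exists_synthesisFeasible_iff_exists_pqFeasible hcard hNc hNo).2 ⟨P, Q, h⟩
    exact ⟨K, Pcl, Y, lam, t, hK, rfl⟩
  · rintro ⟨K, Pcl, Y, lam, t, h, rfl⟩
    obtain ⟨P, Q, hPQ⟩ := h.exists_pqFeasible hNc hNo
    exact ⟨P, Q, Y, lam, t, hPQ, rfl⟩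

omit [DecidableEq m] in
theorem IsStabilizable.exists_stabilizes (hG : IsStabilizable G)
    (hcard : Fintype.card n ≤ Fintype.card ν)
    (hNc : IsOrthonormalKernelBasis (fromCols G.B₂ᴴ G.D₁₂ᴴ) Nc)
    (hNo : IsOrthonormalKernelBasis (fromCols G.C₂ G.D₂₁) No) :
    ∃ K : Controller 𝕜 ν r q, Stabilizes G K := by
  classical
  obtain ⟨d, K, hK⟩ := hG
  obtain ⟨Pcl, Y, lam, t, h, -⟩ := hK.exists_synthesisFeasible_of_lt (lt_add_one _) (k := 0)
  obtain ⟨K', Pcl', h'⟩ := (exists_synthesisFeasible_iff_exists_pqFeasible hcard hNc hNo).2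
    (h.exists_pqFeasible hNc hNo)
  exact ⟨K', h'.stabilizes⟩

omit [DecidableEq m] in
theorem IsStabilizable.exists_isGLB_relaxedNormValues (hG : IsStabilizable G)
    (hcard : Fintype.card n ≤ Fintype.card ν)
    (hNc : IsOrthonormalKernelBasis (fromCols G.B₂ᴴ G.D₁₂ᴴ) Nc)
    (hNo : IsOrthonormalKernelBasis (fromCols G.C₂ G.D₂₁) No) (k : ℕ) :
    ∃ γ, IsGLB (relaxedNormValues ν G k) γ := by
  obtain ⟨K, hK⟩ : ∃ K : Controller 𝕜 ν r q, Stabilizes G K :=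
    hG.exists_stabilizes hcard hNc hNo
  refine ⟨_, isGLB_csInf ⟨_, K, hK, rfl⟩ ⟨0, ?_⟩⟩
  rintro _ ⟨K', -, rfl⟩
  positivity

end OptimalValues

end

theorem mainTheorem6 {𝕜 : Type*} [RCLike 𝕜]
    (n m r p q nK k : ℕ) (hnK : n ≤ nK)
    (G : Plant 𝕜 (Fin n) (Fin m) (Fin r) (Fin p) (Fin q))
    (hG : IsStabilizable G)
    (cc co : ℕ)
    (Nc : Matrix (Fin n ⊕ Fin p) (Fin cc) 𝕜) (No : Matrix (Fin n ⊕ Fin m) (Fin co) 𝕜)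
    (hNc : IsOrthonormalKernelBasis (Matrix.fromCols G.B₂ᴴ G.D₁₂ᴴ) Nc)
    (hNo : IsOrthonormalKernelBasis (Matrix.fromCols G.C₂ G.D₂₁) No) :
    -- the relaxed norm of every stable closed loop is a genuine supremum
    (∀ K : Controller 𝕜 (Fin nK) (Fin r) (Fin q), Stabilizes G K →
      IsLUB (relaxationValues (closedLoop G K) k) (relaxedNorm (closedLoop G K) k ^ 2)) ∧
    -- the synthesis problem and the first program have the same feasible `(Y, λ, t)`
    (∀ (Y : Matrix (Fin m) (Fin m) 𝕜) (lam t : ℝ),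
      (∃ (K : Controller 𝕜 (Fin nK) (Fin r) (Fin q)) (Pcl : _),
        SynthesisFeasible G K Pcl Y lam t) ↔
      ∃ P Q, PQFeasible G Nc No P Q Y lam t) ∧
    ∃ γ : ℝ,
      -- `γ` is the optimal value of the three problems
      IsGLB {v : ℝ | ∃ K : Controller 𝕜 (Fin nK) (Fin r) (Fin q), Stabilizes G K ∧
        v = relaxedNorm (closedLoop G K) k ^ 2} γ ∧
      IsGLB {v : ℝ | ∃ (K : Controller 𝕜 (Fin nK) (Fin r) (Fin q)) (Pcl : _)
        (Y : _) (lam t : ℝ), SynthesisFeasible G K Pcl Y lam t ∧ v = lam + k * t} γ ∧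
      IsGLB {v : ℝ | ∃ (P Q : _) (Y : _) (lam t : ℝ),
        PQFeasible G Nc No P Q Y lam t ∧ v = lam + k * t} γ ∧
      -- reconstruction of `P_cl` and of the controller from a feasible point of the first program
      ∀ (P Q : Matrix (Fin n) (Fin n) 𝕜) (Y : Matrix (Fin m) (Fin m) 𝕜) (lam t : ℝ),
        PQFeasible G Nc No P Q Y lam t →
        (∃ P₂ : Matrix (Fin nK) (Fin n) 𝕜, P - Q⁻¹ = P₂ᴴ * P₂) ∧
        ∀ P₂ : Matrix (Fin nK) (Fin n) 𝕜, P - Q⁻¹ = P₂ᴴ * P₂ →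
          (reconstructedPcl P P₂).PosDef ∧
          (∃ K : Controller 𝕜 (Fin nK) (Fin r) (Fin q),
            ConstructionFeasible G (reconstructedPcl P P₂) K Y lam t) ∧
          (∃ δ : ℝ,
            IsGLB {v : ℝ | ∃ (K : Controller 𝕜 (Fin nK) (Fin r) (Fin q)) (Y' : _)
              (lam' t' : ℝ), ConstructionFeasible G (reconstructedPcl P P₂) K Y' lam' t' ∧
                v = lam' + k * t'} δ ∧
            γ ≤ δ ∧ δ ≤ lam + k * t) ∧
          ∀ (K : Controller 𝕜 (Fin nK) (Fin r) (Fin q)) (Y' : Matrix (Fin m) (Fin m) 𝕜)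
            (lam' t' : ℝ), ConstructionFeasible G (reconstructedPcl P P₂) K Y' lam' t' →
              Stabilizes G K ∧
              SynthesisFeasible G K (reconstructedPcl P P₂) Y' lam' t' ∧
              relaxedNorm (closedLoop G K) k ^ 2 ≤ lam' + k * t' := by
  have hcard : Fintype.card (Fin n) ≤ Fintype.card (Fin nK) := by simpa using hnK
  obtain ⟨γ, hγ⟩ := hG.exists_isGLB_relaxedNormValues (ν := Fin nK) hcard hNc hNo k
  have hsynth : IsGLB (synthesisValues (Fin nK) G k) γ := by
    rwa [IsGLB, lowerBounds_synthesisValues]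
  have hpq : IsGLB (pqValues G Nc No k) γ :=
    pqValues_eq_synthesisValues (ν := Fin nK) hcard hNc hNo k ▸ hsynth
  refine ⟨fun K hK => IsSchurStable.isLUB_relaxedNorm_sq hK k,
    fun Y lam t => exists_synthesisFeasible_iff_exists_pqFeasible hcard hNc hNo,
    γ, hγ, hsynth, hpq, fun P Q Y lam t h =>
      ⟨h.exists_sub_inv_eq_conjTranspose_mul_self hcard, fun P₂ hP₂ => ?_⟩⟩
  have hPcl := posDef_reconstructedPcl h.posDef_right hP₂
  have hfeasible := h.exists_constructionFeasible hNc hNo hP₂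
  refine ⟨hPcl, hfeasible, exists_isGLB_of_mem_lowerBounds ?_ ?_, fun K Y' lam' t' hK => ?_⟩
  · exact lowerBounds_mono_set (constructionValues_subset_synthesisValues hPcl k) hsynth.1
  · exact hfeasible.imp fun K hK => ⟨Y, lam, t, hK, rfl⟩
  · have hK' := (constructionFeasible_iff_synthesisFeasible hPcl).1 hK
    exact ⟨hK'.stabilizes, hK', hK'.relaxedNorm_sq_le k⟩
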